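/- Let $0=x_0<x_1<\dots<x_k=1$ and $0=y_0<y_1<\dots<y_\ell=1$ be real numbers and let $I=(I_{uv})_{1\le u\le k,\,1\le v\le \ell}$ be an array with entries in $\{0,1\}$. Assume that the data are non-degenerate: there is a non-negative array $(B_{uv})$ with $B_{uv}>0$ if and only if $I_{uv}=1$, with $\sum_{v}B_{uv}=x_u-x_{u-1}$ for all $u$ and $\sum_u B_{uv}=y_v-y_{v-1}$ for all $v$. Let $\mathfrak F^{x,y,I}$ be the set of functions $h:[0,1]^2\to\mathbb R$ that are $1$-Lipschitz in each variable, satisfy $h(s_1,t_1)+h(s_2,t_2)-h(s_1,t_2)-h(s_2,t_1)\le 0$ for $s_1<s_2$, $t_1<t_2$ and the boundary conditions $h(s,0)=0$, $h(s,1)=1-s$, $h(0,t)=t$, $h(1,t)=0$, and for which $h(x_u,y_v)+h(x_{u-1},y_{v-1})-h(x_u,y_{v-1})-h(x_{u-1},y_v)=0$ whenever $I_{uv}=0$. Equivalently, $h(s,t)=\mu_h([s,1]\times[0,t])$ for a probability measure $\mu_h$ on $[0,1]^2$ with uniform marginals that gives no mass to the rectangles with $I_{uv}=0$; the density of $\mu_h$,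 if it exists, is denoted $g=-h_{xy}$. For $r\in\mathbb R$ the permuton energy of $h$ is $$\mathfrak E(h)=\int_0^1\!\!\int_0^1\bigl[h_{xy}\ln(-h_{xy})-r\,h_xh_y\bigr]\,dx\,dy ,\qquad 0\ln 0=0,$$ with $\mathfrak E(h)=-\infty$ if $\mu_h$ has no density or the integral does not exist as a finite number. **Theorem.** Let $r=0$. 1. $\mathfrak E$ has exactly one maximizer $h$ on $\mathfrak F^{x,y,I}$. 2. There exist positive reals $\lambda_1,\dots,\lambda_k$ and $\mu_1,\dots,\mu_\ell$ such that $$x_u-x_{u-1}=\sum_{v=1}^{\ell}I_{uv}\lambda_u\mu_v\quad(1\le u\le k),\qquad y_v-y_{v-1}=\sum_{u=1}^{k}I_{uv}\lambda_u\mu_v\quad(1\le v\le\ell).\tag{$*$}$$ 3. For every positive solution $(\lambda,\mu)$ of $(*)$, the maximizer has a density $g$ that is constant on each rectangle: $$g(s,t)=\frac{g^{uv}}{(x_u-x_{u-1})(y_v-y_{v-1})},\qquad g^{uv}=I_{uv}\lambda_u\mu_v,\qquad (s,t)\in(x_{u-1},x_u)\times(y_{v-1},y_v).$$ 4. (Sinkhorn–Knopp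 / iterative proportional fitting.) Put $\mu^{[0]}=(1,\dots,1)$ and, for $n\ge1$, $$\lambda^{[n]}_u=\frac{x_u-x_{u-1}}{\sum_{v}I_{uv}\mu^{[n-1]}_v},\qquad \mu^{[n]}_v=\frac{y_v-y_{v-1}}{\sum_{u}I_{uv}\lambda^{[n]}_u}.$$ All these numbers are well defined and positive, and $(\lambda^{[n]},\mu^{[n]})$ converges as $n\to\infty$ to a positive solution $(\lambda,\mu)$ of $(*)$. -/

import Mathlib

open MeasureTheory Set

/-- The unit square. Height functions are real functions on the plane of which only the values on
this square matter. -/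
def unitSquare : Set (ℝ × ℝ) := Icc 0 1 ×ˢ Icc 0 1

/-- `0 = x_0 < x_1 < ⋯ < x_k = 1`. -/
def IsSubdivision {k : ℕ} (x : Fin (k + 1) → ℝ) : Prop :=
  x 0 = 0 ∧ x (Fin.last k) = 1 ∧ StrictMono x

/-- The length `x_u - x_{u-1}` of the `u`-th interval of the subdivision, the `k` intervals being
indexed by `Fin k`. -/
def gap {k : ℕ} (x : Fin (k + 1) → ℝ) (u : Fin k) : ℝ := x u.succ - x u.castSucc

/-- The open rectangle `(x_{u-1}, x_u) × (y_{v-1}, y_v)`. -/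
def openRect {k l : ℕ} (x : Fin (k + 1) → ℝ) (y : Fin (l + 1) → ℝ) (u : Fin k) (v : Fin l) :
    Set (ℝ × ℝ) :=
  Ioo (x u.castSucc) (x u.succ) ×ˢ Ioo (y v.castSucc) (y v.succ)

/-- Non-degeneracy: some non-negative array supported exactly on `{I = 1}` has row sums
`x_u - x_{u-1}` and column sums `y_v - y_{v-1}`. -/
def NonDegenerate {k l : ℕ} (x : Fin (k + 1) → ℝ) (y : Fin (l + 1) → ℝ)
    (I : Fin k → Fin l → ℝ) : Prop :=
  ∃ B : Fin k → Fin l → ℝ, (∀ u v, 0 ≤ B u v) ∧ (∀ u v, 0 < B u v ↔ I u v = 1) ∧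
    (∀ u, ∑ v, B u v = gap x u) ∧ (∀ v, ∑ u, B u v = gap y v)

/-- The class of height functions of permutons. -/
structure IsHeightFunction (h : ℝ × ℝ → ℝ) : Prop where
  lipschitz_x : ∀ y ∈ Icc (0 : ℝ) 1, LipschitzOnWith 1 (fun x => h (x, y)) (Icc 0 1)
  lipschitz_y : ∀ x ∈ Icc (0 : ℝ) 1, LipschitzOnWith 1 (fun y => h (x, y)) (Icc 0 1)
  rectangle : ∀ x₁ x₂ y₁ y₂ : ℝ, 0 ≤ x₁ → x₁ < x₂ → x₂ ≤ 1 → 0 ≤ y₁ → y₁ < y₂ → y₂ ≤ 1 →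
    h (x₁, y₁) + h (x₂, y₂) - h (x₁, y₂) - h (x₂, y₁) ≤ 0
  bottom : ∀ x ∈ Icc (0 : ℝ) 1, h (x, 0) = 0
  top : ∀ x ∈ Icc (0 : ℝ) 1, h (x, 1) = 1 - x
  left : ∀ y ∈ Icc (0 : ℝ) 1, h (0, y) = y
  right : ∀ y ∈ Icc (0 : ℝ) 1, h (1, y) = 0

/-- The height functions whose permuton puts no mass on the rectangles with `I u v = 0`. -/
def restrictedHeights {k l : ℕ} (x : Fin (k + 1) → ℝ) (y : Fin (l + 1) → ℝ)
    (I : Fin k → Fin l → ℝ) : Set (ℝ × ℝ → ℝ) :=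
  {h | IsHeightFunction h ∧ ∀ u v, I u v = 0 →
    h (x u.succ, y v.succ) + h (x u.castSucc, y v.castSucc)
      - h (x u.succ, y v.castSucc) - h (x u.castSucc, y v.succ) = 0}

/-- `g = -h_{xy}` is the density of the permuton with height function `h`, that is
`h (x, y) = ∫_0^y ∫_x^1 g (s, t) ds dt`. -/
structure IsDensity (h g : ℝ × ℝ → ℝ) : Prop where
  integrableOn : IntegrableOn g unitSquare
  nonneg : ∀ p ∈ unitSquare, 0 ≤ g p
  eq_integral : ∀ x ∈ Icc (0 : ℝ) 1, ∀ y ∈ Icc (0 : ℝ) 1,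
    h (x, y) = ∫ p in Icc x 1 ×ˢ Icc 0 y, g p

/-- The integrand `h_{xy} ln (-h_{xy}) - r h_x h_y`, with `g` in the place of `-h_{xy}`. -/
noncomputable def energyIntegrand (r : ℝ) (h g : ℝ × ℝ → ℝ) (p : ℝ × ℝ) : ℝ :=
  -(g p * Real.log (g p))
    - r * deriv (fun s => h (s, p.2)) p.1 * deriv (fun t => h (p.1, t)) p.2

open Classical in
/-- The permuton energy; it is `-∞` if the permuton has no density or if the integral does not
exist. It does not depend on the choice of the density, see `permutonEnergy_eq`. -/
noncomputable def permutonEnergy (r : ℝ) (h : ℝ × ℝ → ℝ) : EReal :=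
  if H : ∃ g, IsDensity h g ∧ IntegrableOn (energyIntegrand r h g) unitSquare then
    ((∫ p in unitSquare, energyIntegrand r h H.choose p : ℝ) : EReal)
  else ⊥

/-- `h` maximizes the permuton energy over the class of restricted height functions. -/
def IsEnergyMaximizer (r : ℝ) {k l : ℕ} (x : Fin (k + 1) → ℝ) (y : Fin (l + 1) → ℝ)
    (I : Fin k → Fin l → ℝ) (h : ℝ × ℝ → ℝ) : Prop :=
  h ∈ restrictedHeights x y I ∧
    ∀ h' ∈ restrictedHeights x y I, permutonEnergy r h' ≤ permutonEnergy r h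

/-- `lam`, `mu` are positive and scale `I` to an array with row sums `x_u - x_{u-1}` and column
sums `y_v - y_{v-1}`. -/
structure IsScaling {k l : ℕ} (x : Fin (k + 1) → ℝ) (y : Fin (l + 1) → ℝ)
    (I : Fin k → Fin l → ℝ) (lam : Fin k → ℝ) (mu : Fin l → ℝ) : Prop where
  lam_pos : ∀ u, 0 < lam u
  mu_pos : ∀ v, 0 < mu v
  row_sum : ∀ u, gap x u = ∑ v, I u v * lam u * mu v
  col_sum : ∀ v, gap y v = ∑ u, I u v * lam u * mu v

/-- One half step of iterative proportional fitting: the `lam` that fits the row sums to `mu`. -/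
noncomputable def fitRows {k l : ℕ} (x : Fin (k + 1) → ℝ) (I : Fin k → Fin l → ℝ)
    (mu : Fin l → ℝ) (u : Fin k) : ℝ :=
  gap x u / ∑ v, I u v * mu v

/-- The other half step: the `mu` that fits the column sums to `lam`. -/
noncomputable def fitCols {k l : ℕ} (y : Fin (l + 1) → ℝ) (I : Fin k → Fin l → ℝ)
    (lam : Fin k → ℝ) (v : Fin l) : ℝ :=
  gap y v / ∑ u, I u v * lam u

/-- The Sinkhorn–Knopp iterates `mu^[n]`, `n = 0, 1, 2, …`, started at `mu^[0] = (1, …, 1)`. -/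
noncomputable def sinkhornMu {k l : ℕ} (x : Fin (k + 1) → ℝ) (y : Fin (l + 1) → ℝ)
    (I : Fin k → Fin l → ℝ) : ℕ → Fin l → ℝ
  | 0 => fun _ => 1
  | n + 1 => fitCols y I (fitRows x I (sinkhornMu x y I n))

/-- The Sinkhorn–Knopp iterates on the row side: `sinkhornLam x y I n` is `lam^[n+1]`, computed from
`mu^[n]`. -/
noncomputable def sinkhornLam {k l : ℕ} (x : Fin (k + 1) → ℝ) (y : Fin (l + 1) → ℝ)
    (I : Fin k → Fin l → ℝ) (n : ℕ) : Fin k → ℝ :=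
  fitRows x I (sinkhornMu x y I n)

/-- Two densities of the same permuton agree almost everywhere. -/
theorem IsDensity.ae_eq {h g g' : ℝ × ℝ → ℝ} (hg : IsDensity h g) (hg' : IsDensity h g') :
    g =ᵐ[volume.restrict unitSquare] g' := by
  have hS : MeasurableSet unitSquare := measurableSet_Icc.prod measurableSet_Icc
  have key : ∀ f : ℝ × ℝ → ℝ, IsDensity h f → ∀ a b : ℝ,
      ((volume.restrict unitSquare).withDensity fun p => ENNReal.ofReal (f p)) (Ici a ×ˢ Iic b)
        = if a ≤ 1 ∧ 0 ≤ b then ENNReal.ofReal (h (max a 0, min b 1)) else 0 := by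
    intro f hf a b
    have hm : MeasurableSet (Ici a ×ˢ Iic b : Set (ℝ × ℝ)) := measurableSet_Ici.prod measurableSet_Iic
    rw [withDensity_apply _ hm, Measure.restrict_restrict hm]
    split_ifs with hab
    · have hset : (Ici a ×ˢ Iic b ∩ unitSquare : Set (ℝ × ℝ))
          = Icc (max a 0) 1 ×ˢ Icc 0 (min b 1) := by
        ext p
        simp only [unitSquare, mem_inter_iff, mem_prod, mem_Ici, mem_Iic, mem_Icc, max_le_iff,
          le_min_iff]
        tauto
      have hsub : (Icc (max a 0) 1 ×ˢ Icc 0 (min b 1) : Set (ℝ × ℝ)) ⊆ unitSquare := by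
        rw [← hset]; exact inter_subset_right
      rw [hset, hf.eq_integral _ ⟨le_max_right _ _, max_le hab.1 zero_le_one⟩ _
        ⟨le_min hab.2 zero_le_one, min_le_right _ _⟩,
        ofReal_integral_eq_lintegral_ofReal (hf.integrableOn.mono_set hsub)]
      exact (ae_restrict_iff' (measurableSet_Icc.prod measurableSet_Icc)).2
        (Filter.Eventually.of_forall fun p hp => hf.nonneg p (hsub hp))
    · have hset : (Ici a ×ˢ Iic b ∩ unitSquare : Set (ℝ × ℝ)) = ∅ := by
        ext p
        simp only [unitSquare, mem_inter_iff, mem_prod, mem_Ici, mem_Iic, mem_Icc,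
          mem_empty_iff_false, iff_false]
        rintro ⟨⟨h1, h2⟩, ⟨h3, h4⟩, h5, h6⟩
        exact hab ⟨h1.trans h4, h5.trans h2⟩
      rw [hset]; simp
  have hfin : ∀ f : ℝ × ℝ → ℝ, IsDensity h f →
      (∫⁻ p, ENNReal.ofReal (f p) ∂volume.restrict unitSquare) ≠ ⊤ := fun f hf =>
    (hf.integrableOn.lintegral_lt_top).ne
  have hmeas : ((volume.restrict unitSquare).withDensity fun p => ENNReal.ofReal (g p))
      = (volume.restrict unitSquare).withDensity fun p => ENNReal.ofReal (g' p) := by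
    have := isFiniteMeasure_withDensity (hfin g hg)
    have := isFiniteMeasure_withDensity (hfin g' hg')
    have hgen : (inferInstance : MeasurableSpace (ℝ × ℝ))
        = MeasurableSpace.generateFrom (image2 (· ×ˢ ·) (range Ici) (range Iic)) := by
      have h1 : IsCountablySpanning (range (Ici : ℝ → Set ℝ)) := by
        refine ⟨fun n : ℕ => Ici (-(n : ℝ)), fun n => ⟨_, rfl⟩, eq_univ_of_forall fun t => ?_⟩
        obtain ⟨n, hn⟩ := exists_nat_ge (-t)
        exact mem_iUnion.2 ⟨n, mem_Ici.2 (by linarith)⟩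
      have h2 : IsCountablySpanning (range (Iic : ℝ → Set ℝ)) := by
        refine ⟨fun n : ℕ => Iic (n : ℝ), fun n => ⟨_, rfl⟩, eq_univ_of_forall fun t => ?_⟩
        obtain ⟨n, hn⟩ := exists_nat_ge t
        exact mem_iUnion.2 ⟨n, mem_Iic.2 hn⟩
      exact (generateFrom_eq_prod
        ((borel_eq_generateFrom_Ici ℝ).symm.trans (BorelSpace.measurable_eq (α := ℝ)).symm)
        ((borel_eq_generateFrom_Iic ℝ).symm.trans (BorelSpace.measurable_eq (α := ℝ)).symm)
        h1 h2).symm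
    refine ext_of_generate_finite _ hgen (isPiSystem_Ici.prod isPiSystem_Iic) ?_ ?_
    · rintro _ ⟨_, ⟨a, rfl⟩, _, ⟨b, rfl⟩, rfl⟩
      exact (key g hg a b).trans (key g' hg' a b).symm
    · have huniv : ∀ f : ℝ × ℝ → ℝ, IsDensity h f →
          ((volume.restrict unitSquare).withDensity fun p => ENNReal.ofReal (f p)) univ
            = ENNReal.ofReal (h (0, 1)) := by
        intro f hf
        have h0 := hf.eq_integral 0 ⟨le_rfl, zero_le_one⟩ 1 ⟨zero_le_one, le_rfl⟩
        rw [withDensity_apply _ MeasurableSet.univ, Measure.restrict_univ, h0,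
          ← unitSquare, ofReal_integral_eq_lintegral_ofReal hf.integrableOn]
        exact (ae_restrict_iff' hS).2 (Filter.Eventually.of_forall hf.nonneg)
      rw [huniv g hg, huniv g' hg']
  have hofr := (withDensity_eq_iff hg.integrableOn.aemeasurable.ennreal_ofReal
    hg'.integrableOn.aemeasurable.ennreal_ofReal (hfin g hg)).1 hmeas
  filter_upwards [hofr, ae_restrict_mem hS] with p hp hpS
  exact (ENNReal.ofReal_eq_ofReal_iff (hg.nonneg p hpS) (hg'.nonneg p hpS)).1 hp

/-- The permuton energy can be computed from any density. -/
theorem permutonEnergy_eq {r : ℝ} {h g : ℝ × ℝ → ℝ} (hg : IsDensity h g)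
    (hi : IntegrableOn (energyIntegrand r h g) unitSquare) :
    permutonEnergy r h = ((∫ p in unitSquare, energyIntegrand r h g p : ℝ) : EReal) := by
  have H : ∃ g, IsDensity h g ∧ IntegrableOn (energyIntegrand r h g) unitSquare := ⟨g, hg, hi⟩
  rw [permutonEnergy, dif_pos H]
  congr 1
  refine integral_congr_ae ?_
  filter_upwards [H.choose_spec.1.ae_eq hg] with p hp
  simp only [energyIntegrand, hp]

/-! Everything rests on the fact that the density `g*` built from a scaling has a logarithm of the
form `a_u + b_v` on the rectangles with `I = 1`. For any admissible density `g`, the integral of `g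
log g*` sees only the row and column masses of `g`, which the uniform marginals prescribe. Hence the
energy of `g` equals a constant minus the integral of `g* - g + g log g - g log g*`
(`IsScaling.setIntegral_energyIntegrand`). This integrand is the gap between `z log z` and its
tangent at `g*`: it is nonnegative and vanishes only where `g = g*` (`entropy_deficit`). So every
scaling yields the maximizer, and every maximizer has the density `g*`.

A scaling exists because the convex function `∑ (I exp s - B s)` is coercive on the arrays `s = I
(α_u + β_v)`; stationarity at its minimum, tested on rows and columns, is the system of marginal
equations (`exists_exp_orthogonal`, `exists_isScaling`).

For Sinkhorn–Knopp, one full step on `mu` is monotone and homogeneous of degree one, and its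
positive fixed points are the scalings. Order intervals between multiples of a fixed point are
therefore invariant, so the iterates stay in a compact set. A potential decreases strictly except at
fixed points (`Fittable.dualPotential_fit_add_le`), so some limit point is a fixed point. Small
order intervals around it then trap the whole sequence. -/

section Scaling

variable {k l : ℕ} {x : Fin (k + 1) → ℝ} {y : Fin (l + 1) → ℝ} {I : Fin k → Fin l → ℝ}

/-! ### Existence of a scaling by convex minimization. -/

theorem IsSubdivision.gap_pos (hx : IsSubdivision x) (u : Fin k) : 0 < gap x u :=
  sub_pos.2 (hx.2.2 u.castSucc_lt_succ)

theorem sum_fin_succ_sub_castSucc (f : Fin (k + 1) → ℝ) :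
    ∑ u : Fin k, (f u.succ - f u.castSucc) = f (Fin.last k) - f 0 := by
  induction k with
  | zero => simp
  | succ n ih =>
    rw [Fin.sum_univ_castSucc]
    have := ih (fun i => f i.castSucc)
    simp only [Fin.succ_castSucc, Fin.castSucc_zero] at this ⊢
    rw [this, Fin.succ_last]
    ring

theorem IsSubdivision.sum_gap (hx : IsSubdivision x) : ∑ u, gap x u = 1 := by
  simp only [gap]
  rw [sum_fin_succ_sub_castSucc, hx.1, hx.2.1, sub_zero]

/-- A linear lower bound of `exp z - b z` in `|z|`. -/
theorem exists_exp_sub_mul_lower_bound {b : ℝ} (hb : 0 < b) :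
    ∃ d K : ℝ, 0 < d ∧ 0 ≤ K ∧ ∀ z, d * |z| - K ≤ Real.exp z - b * z := by
  -- For `z ≥ 0` the tangent to `exp` of slope `b + 1` leaves slope 1 after subtracting `b z`, and
  -- its intercept is `(b + 1)(1 - log (b + 1))`; for `z ≤ 0` the term `-b z` alone suffices.
  refine ⟨min b 1, |(b + 1) * (1 - Real.log (b + 1))|, lt_min hb one_pos, abs_nonneg _,
    fun z => ?_⟩
  have hK := neg_abs_le ((b + 1) * (1 - Real.log (b + 1)))
  rcases le_total 0 z with hz | hz
  · rw [abs_of_nonneg hz]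
    have h1 : min b 1 * z ≤ 1 * z := mul_le_mul_of_nonneg_right (min_le_right _ _) hz
    have h2 := Real.add_one_le_exp (z - Real.log (b + 1))
    rw [Real.exp_sub, Real.exp_log (by linarith), le_div_iff₀ (by linarith)] at h2
    linarith
  · rw [abs_of_nonpos hz]
    have h1 : min b 1 * -z ≤ b * -z :=
      mul_le_mul_of_nonneg_right (min_le_left _ _) (by linarith)
    have h2 := Real.exp_pos z
    have h3 := abs_nonneg ((b + 1) * (1 - Real.log (b + 1)))
    linarith

/-- The convex function `∑ (exp s - B s)` attains its minimum on every subspace of arrays that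
vanish off the support of `B`, and the gradient at a minimizer is orthogonal to the subspace. -/
theorem exists_exp_orthogonal {ι : Type*} [Fintype ι] (J B : ι → ℝ)
    (hJ : ∀ p, J p = 0 ∧ B p = 0 ∨ J p = 1 ∧ 0 < B p) (S : Submodule ℝ (ι → ℝ))
    (hS : ∀ s ∈ S, ∀ p, J p = 0 → s p = 0) :
    ∃ s ∈ S, ∀ d ∈ S, ∑ p, (J p * Real.exp (s p) - B p) * d p = 0 := by
  classical
  set f : (ι → ℝ) → ℝ := fun s => ∑ p, (J p * Real.exp (s p) - B p * s p) with hf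
  have hbound : ∀ p, ∃ d K : ℝ, 0 < d ∧ 0 ≤ K ∧ ∀ z, (J p = 0 → z = 0) →
      d * |z| - K ≤ J p * Real.exp z - B p * z := by
    intro p
    rcases hJ p with ⟨h1, h2⟩ | ⟨h1, h2⟩
    -- Off the support the coordinate is zero on `S`, so any constants serve.
    · refine ⟨1, 0, one_pos, le_rfl, fun z hz => ?_⟩
      rw [hz h1, h1, h2]; simp
    · obtain ⟨d, K, hd, hK, h⟩ := exists_exp_sub_mul_lower_bound h2
      refine ⟨d, K, hd, hK, fun z _ => ?_⟩
      rw [h1, one_mul]; exact h z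
  choose d K hd hK hdK using hbound
  have hlow : ∀ s ∈ S, ∀ p, d p * |s p| - ∑ q, K q ≤ f s := by
    intro s hs p
    calc d p * |s p| - ∑ q, K q ≤ ∑ q, d q * |s q| - ∑ q, K q := by
          gcongr
          exact Finset.single_le_sum (f := fun q => d q * |s q|)
            (fun q _ => mul_nonneg (hd q).le (abs_nonneg _)) (Finset.mem_univ p)
      _ = ∑ q, (d q * |s q| - K q) := by rw [Finset.sum_sub_distrib]
      _ ≤ f s := Finset.sum_le_sum fun q _ => hdK q _ (hS s hs q)
  have hf0 : 0 ≤ f 0 := by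
    refine Finset.sum_nonneg fun p _ => ?_
    rcases hJ p with ⟨h1, -⟩ | ⟨h1, -⟩ <;> simp [h1]
  have hr : ∀ p, 0 ≤ (f 0 + ∑ q, K q) / d p := fun p =>
    div_nonneg (add_nonneg hf0 (Finset.sum_nonneg fun q _ => hK q)) (hd p).le
  -- By `hlow`, leaving this box in any coordinate forces a value above `f 0`, so the minimum over
  -- the compact part of `S` is global on `S`.
  set box : Set (ι → ℝ) := Set.pi univ fun p =>
    Icc (-((f 0 + ∑ q, K q) / d p)) ((f 0 + ∑ q, K q) / d p) with hbox
  have hfc : Continuous f := by rw [hf]; fun_prop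
  have hcomp : IsCompact (box ∩ (S : Set (ι → ℝ))) :=
    (isCompact_univ_pi fun p => isCompact_Icc).inter_right S.closed_of_finiteDimensional
  have h0box : (0 : ι → ℝ) ∈ box := fun p _ => ⟨by simpa using hr p, hr p⟩
  obtain ⟨s, ⟨-, hsS⟩, hmin⟩ :=
    hcomp.exists_isMinOn ⟨0, h0box, S.zero_mem⟩ hfc.continuousOn
  have hglob : ∀ t ∈ S, f s ≤ f t := by
    intro t ht
    by_cases htb : t ∈ box
    · exact hmin ⟨htb, ht⟩
    · obtain ⟨p, hp⟩ : ∃ p, (f 0 + ∑ q, K q) / d p < |t p| := by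
        by_contra! hcon
        exact htb fun p _ => abs_le.1 (hcon p)
      rw [div_lt_iff₀ (hd p)] at hp
      have h1 := hlow t ht p
      have h2 : f s ≤ f 0 := hmin ⟨h0box, S.zero_mem⟩
      linarith
  refine ⟨s, hsS, fun e he => ?_⟩
  have hder : HasDerivAt (fun τ : ℝ => f (s + τ • e))
      (∑ p, (J p * Real.exp (s p) - B p) * e p) 0 := by
    have hp : ∀ p ∈ (Finset.univ : Finset ι), HasDerivAt
        (fun τ : ℝ => J p * Real.exp (s p + τ * e p) - B p * (s p + τ * e p))
        ((J p * Real.exp (s p) - B p) * e p) 0 := by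
      intro p _
      have h1 : HasDerivAt (fun τ : ℝ => s p + τ * e p) (e p) 0 := by
        simpa using ((hasDerivAt_id (0 : ℝ)).mul_const (e p)).const_add (s p)
      have h2 := (h1.exp.const_mul (J p)).sub (h1.const_mul (B p))
      refine h2.congr_deriv ?_
      simp only [zero_mul, add_zero]
      ring
    have h3 := HasDerivAt.fun_sum hp
    exact h3
  refine IsLocalMin.hasDerivAt_eq_zero (Filter.Eventually.of_forall fun τ => ?_) hder
  simpa using hglob _ (S.add_mem hsS (S.smul_mem τ he))

/-- The exponents of `lam` and `mu` are the unknowns. The minimization runs over the range of `L`,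
not over pairs `(α, β)`: shifting `α` by a constant and `β` by its negative does not change the
array, so coercivity fails for the pairs. -/
theorem exists_isScaling (hI : ∀ u v, I u v = 0 ∨ I u v = 1) (hnd : NonDegenerate x y I) :
    ∃ lam mu, IsScaling x y I lam mu := by
  obtain ⟨B, hB0, hBI, hrow, hcol⟩ := hnd
  let L : ((Fin k → ℝ) × (Fin l → ℝ)) →ₗ[ℝ] (Fin k × Fin l → ℝ) :=
    { toFun := fun q p => I p.1 p.2 * (q.1 p.1 + q.2 p.2)
      map_add' := fun q q' => by ext p; simp; ring
      map_smul' := fun c q => by ext p; simp; ring }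
  have hL : ∀ q p, L q p = I p.1 p.2 * (q.1 p.1 + q.2 p.2) := fun _ _ => rfl
  have hB : ∀ u v, I u v = 0 ∧ B u v = 0 ∨ I u v = 1 ∧ 0 < B u v := by
    intro u v
    rcases hI u v with h | h
    · refine Or.inl ⟨h, le_antisymm (not_lt.1 fun h' => ?_) (hB0 u v)⟩
      rw [(hBI u v).1 h'] at h
      exact one_ne_zero h
    · exact Or.inr ⟨h, (hBI u v).2 h⟩
  obtain ⟨_, ⟨⟨α, β⟩, rfl⟩, hs⟩ := exists_exp_orthogonal (fun p : Fin k × Fin l => I p.1 p.2)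
    (fun p => B p.1 p.2) (fun p => hB p.1 p.2) (LinearMap.range L) (by
      rintro _ ⟨q, rfl⟩ p hp
      rw [hL, hp, zero_mul])
  -- The factor `I u v` of a test direction is harmless: `I` is idempotent and `B` vanishes where
  -- `I` does.
  have hterm : ∀ u v, (I u v * Real.exp (L (α, β) (u, v)) - B u v) * I u v
      = I u v * Real.exp (α u) * Real.exp (β v) - B u v := by
    intro u v
    rw [hL]
    rcases hB u v with ⟨h1, h2⟩ | ⟨h1, h2⟩
    · simp [h1, h2]
    · simp [h1, Real.exp_add]
  refine ⟨fun u => Real.exp (α u), fun v => Real.exp (β v), fun u => Real.exp_pos _,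
    fun v => Real.exp_pos _, fun u => ?_, fun v => ?_⟩
  -- Stationarity in the direction of the `u`-th row is the `u`-th row equation, since `B` has the
  -- right row sums.
  · have h := hs _ ⟨(Pi.single u 1, 0), rfl⟩
    rw [Fintype.sum_prod_type, Finset.sum_eq_single u] at h
    · simp only [hL (Pi.single u 1, 0), Pi.single_eq_same, Pi.zero_apply, add_zero, mul_one,
        hterm, Finset.sum_sub_distrib, hrow] at h
      linarith
    · intro u' _ hu
      simp [hL (Pi.single u 1, 0), Pi.single_eq_of_ne hu]
    · simp
  · have h := hs _ ⟨(0, Pi.single v 1), rfl⟩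
    rw [Fintype.sum_prod_type_right, Finset.sum_eq_single v] at h
    · simp only [hL (0, Pi.single v 1), Pi.single_eq_same, Pi.zero_apply, zero_add, mul_one,
        hterm, Finset.sum_sub_distrib, hcol] at h
      linarith
    · intro v' _ hv
      simp [hL (0, Pi.single v 1), Pi.single_eq_of_ne hv]
    · simp

/-! ### Iterative proportional fitting: monotonicity, potential and convergence. -/

theorem NonDegenerate.exists_row (hx : IsSubdivision x) (hnd : NonDegenerate x y I) (u : Fin k) :
    ∃ v, I u v = 1 := by
  obtain ⟨B, hB0, hBI, hrow, hcol⟩ := hnd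
  obtain ⟨v, -, hv⟩ := Finset.exists_lt_of_sum_lt (s := Finset.univ) (f := fun _ => (0 : ℝ))
    (g := B u) (by rw [hrow]; simpa using hx.gap_pos u)
  exact ⟨v, (hBI u v).1 hv⟩

theorem NonDegenerate.exists_col (hy : IsSubdivision y) (hnd : NonDegenerate x y I) (v : Fin l) :
    ∃ u, I u v = 1 := by
  obtain ⟨B, hB0, hBI, hrow, hcol⟩ := hnd
  obtain ⟨u, -, hu⟩ := Finset.exists_lt_of_sum_lt (s := Finset.univ) (f := fun _ => (0 : ℝ))
    (g := fun u => B u v) (by rw [hcol]; simpa using hy.gap_pos v)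
  exact ⟨u, (hBI u v).1 hu⟩

/-- The hypotheses on the zero-one array that make the fitting steps well defined. -/
structure Fittable (x : Fin (k + 1) → ℝ) (y : Fin (l + 1) → ℝ) (I : Fin k → Fin l → ℝ) :
    Prop where
  hx : IsSubdivision x
  hy : IsSubdivision y
  nonneg : ∀ u v, 0 ≤ I u v
  row : ∀ u, ∃ v, 0 < I u v
  col : ∀ v, ∃ u, 0 < I u v

namespace Fittable

theorem row_pos (H : Fittable x y I) {mu : Fin l → ℝ} (hmu : ∀ v, 0 < mu v)
    (u : Fin k) : 0 < ∑ v, I u v * mu v := by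
  obtain ⟨v, hv⟩ := H.row u
  exact Finset.sum_pos' (fun v _ => mul_nonneg (H.nonneg u v) (hmu v).le)
    ⟨v, Finset.mem_univ v, mul_pos hv (hmu v)⟩

theorem col_pos (H : Fittable x y I) {lam : Fin k → ℝ} (hlam : ∀ u, 0 < lam u) (v : Fin l) :
    0 < ∑ u, I u v * lam u := by
  obtain ⟨u, hu⟩ := H.col v
  exact Finset.sum_pos' (fun u _ => mul_nonneg (H.nonneg u v) (hlam u).le)
    ⟨u, Finset.mem_univ u, mul_pos hu (hlam u)⟩

theorem fitRows_pos (H : Fittable x y I) {mu : Fin l → ℝ} (hmu : ∀ v, 0 < mu v)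
    (u : Fin k) : 0 < fitRows x I mu u :=
  div_pos (H.hx.gap_pos u) (H.row_pos hmu u)

theorem fitCols_pos (H : Fittable x y I) {lam : Fin k → ℝ} (hlam : ∀ u, 0 < lam u) (v : Fin l) :
    0 < fitCols y I lam v :=
  div_pos (H.hy.gap_pos v) (H.col_pos hlam v)

theorem sinkhornMu_pos (H : Fittable x y I) (n : ℕ) (v : Fin l) : 0 < sinkhornMu x y I n v := by
  induction n generalizing v with
  | zero => exact one_pos
  | succ n ih => exact H.fitCols_pos (H.fitRows_pos ih) v

/-- `lam u` factors out of the `u`-th row equation and `mu v` out of the `v`-th column equation, so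
each can be solved for that unknown. -/
theorem isScaling_iff (H : Fittable x y I) {lam : Fin k → ℝ} {mu : Fin l → ℝ} (hmu : ∀ v, 0 < mu v)
    (hlam : ∀ u, 0 < lam u) :
    IsScaling x y I lam mu ↔ lam = fitRows x I mu ∧ mu = fitCols y I lam := by
  have hr : ∀ u, gap x u = ∑ v, I u v * lam u * mu v ↔ lam u = fitRows x I mu u := by
    intro u
    rw [fitRows, eq_div_iff (H.row_pos hmu u).ne', Finset.mul_sum, eq_comm]
    exact Eq.congr_left (Finset.sum_congr rfl fun v _ => by ring)
  have hc : ∀ v, gap y v = ∑ u, I u v * lam u * mu v ↔ mu v = fitCols y I lam v := by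
    intro v
    rw [fitCols, eq_div_iff (H.col_pos hlam v).ne', Finset.mul_sum, eq_comm]
    exact Eq.congr_left (Finset.sum_congr rfl fun v _ => by ring)
  exact ⟨fun h => ⟨funext fun u => (hr u).1 (h.row_sum u), funext fun v => (hc v).1 (h.col_sum v)⟩,
    fun h => ⟨hlam, hmu, fun u => (hr u).2 (congrFun h.1 u), fun v => (hc v).2 (congrFun h.2 v)⟩⟩

theorem fitRows_antitone (H : Fittable x y I) {mu mu' : Fin l → ℝ} (hmu : ∀ v, 0 < mu v)
    (h : ∀ v, mu v ≤ mu' v)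
    (u : Fin k) : fitRows x I mu' u ≤ fitRows x I mu u :=
  div_le_div_of_nonneg_left (H.hx.gap_pos u).le (H.row_pos hmu u)
    (Finset.sum_le_sum fun v _ => mul_le_mul_of_nonneg_left (h v) (H.nonneg u v))

theorem fitCols_antitone (H : Fittable x y I) {lam lam' : Fin k → ℝ} (hlam : ∀ u, 0 < lam u)
    (h : ∀ u, lam u ≤ lam' u) (v : Fin l) : fitCols y I lam' v ≤ fitCols y I lam v :=
  div_le_div_of_nonneg_left (H.hy.gap_pos v).le (H.col_pos hlam v)
    (Finset.sum_le_sum fun u _ => mul_le_mul_of_nonneg_left (h u) (H.nonneg u v))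

/-- Each half step is homogeneous of degree `-1`, so the two together have degree one. -/
theorem fit_smul (c : ℝ) (mu : Fin l → ℝ) :
    fitCols y I (fitRows x I (c • mu)) = c • fitCols y I (fitRows x I mu) := by
  have h1 : fitRows x I (c • mu) = c⁻¹ • fitRows x I mu := by
    ext u
    simp only [fitRows, Pi.smul_apply, smul_eq_mul, mul_left_comm _ c, ← Finset.mul_sum]
    rw [div_eq_mul_inv, mul_inv]; ring
  ext v
  rw [h1]
  simp only [fitCols, Pi.smul_apply, smul_eq_mul, mul_left_comm _ c⁻¹, ← Finset.mul_sum]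
  rw [div_eq_mul_inv, mul_inv, inv_inv]; ring

/-- Each half step reverses the order, so the two together preserve it. -/
theorem fit_monotone (H : Fittable x y I) {mu mu' : Fin l → ℝ} (hmu : ∀ v, 0 < mu v)
    (h : ∀ v, mu v ≤ mu' v)
    (v : Fin l) :
    fitCols y I (fitRows x I mu) v ≤ fitCols y I (fitRows x I mu') v :=
  H.fitCols_antitone (H.fitRows_pos fun v => (hmu v).trans_le (h v))
    (H.fitRows_antitone hmu h) v

/-- Order intervals spanned by multiples of a fixed point are invariant. -/
theorem sinkhornMu_mem_box (H : Fittable x y I) {mu : Fin l → ℝ} (hmu : ∀ v, 0 < mu v)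
    (hfix : fitCols y I (fitRows x I mu) = mu) {c d : ℝ} (hc : 0 < c) {n : ℕ}
    (hn : ∀ v, c * mu v ≤ sinkhornMu x y I n v ∧ sinkhornMu x y I n v ≤ d * mu v) {m : ℕ}
    (hm : n ≤ m) (v : Fin l) :
    c * mu v ≤ sinkhornMu x y I m v ∧ sinkhornMu x y I m v ≤ d * mu v := by
  induction m, hm using Nat.le_induction generalizing v with
  | base => exact hn v
  | succ m _ ih =>
    constructor
    · have h := H.fit_monotone (mu := c • mu) (fun v => mul_pos hc (hmu v)) (fun v => (ih v).1) v
      rw [fit_smul, hfix] at h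
      exact h
    · have h := H.fit_monotone (mu' := d • mu) (H.sinkhornMu_pos m) (fun v => (ih v).2) v
      rw [fit_smul, hfix] at h
      exact h

theorem continuousAt_fitRows (H : Fittable x y I) {mu : Fin l → ℝ} (hmu : ∀ v, 0 < mu v) :
    ContinuousAt (fitRows x I) mu := by
  refine continuousAt_pi.2 fun u => ?_
  refine ContinuousAt.div continuousAt_const ?_ (H.row_pos hmu u).ne'
  exact Continuous.continuousAt (by fun_prop)

theorem continuousAt_fitCols (H : Fittable x y I) {lam : Fin k → ℝ} (hlam : ∀ u, 0 < lam u) :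
    ContinuousAt (fitCols y I) lam := by
  refine continuousAt_pi.2 fun v => ?_
  refine ContinuousAt.div continuousAt_const ?_ (H.col_pos hlam v).ne'
  exact Continuous.continuousAt (by fun_prop)

/-- The dual objective of the scaling problem, with the row variables eliminated. -/
noncomputable def dualPotential (x : Fin (k + 1) → ℝ) (y : Fin (l + 1) → ℝ)
    (I : Fin k → Fin l → ℝ) (mu : Fin l → ℝ) : ℝ :=
  ∑ u, gap x u * Real.log (∑ v, I u v * mu v) - ∑ v, gap y v * Real.log (mu v)

theorem continuousAt_dualPotential (H : Fittable x y I) {mu : Fin l → ℝ} (hmu : ∀ v, 0 < mu v) :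
    ContinuousAt (dualPotential x y I) mu := by
  refine ContinuousAt.sub (tendsto_finsetSum _ fun u _ => ?_) (tendsto_finsetSum _ fun v _ => ?_)
  · refine ContinuousAt.mul continuousAt_const (ContinuousAt.log ?_ (H.row_pos hmu u).ne')
    exact Continuous.continuousAt (by fun_prop)
  · exact ContinuousAt.mul continuousAt_const
      (ContinuousAt.log (continuous_apply v).continuousAt (hmu v).ne')

/-- The change of the potential is a weighted sum of logarithms of ratios. In the row part, `log z ≤
z - 1` gives a bound that sums to zero by conservation of mass. In the column part the linear terms
also sum to zero, and what remains is exactly the stated deficit. -/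
theorem dualPotential_fit_add_le (H : Fittable x y I) {mu : Fin l → ℝ} (hmu : ∀ v, 0 < mu v) :
    dualPotential x y I (fitCols y I (fitRows x I mu))
      + ∑ v, gap y v * (mu v / fitCols y I (fitRows x I mu) v - 1
          - Real.log (mu v / fitCols y I (fitRows x I mu) v)) ≤ dualPotential x y I mu := by
  set lam := fitRows x I mu with hlam_def
  set mu' := fitCols y I lam with hmu'_def
  have hlam := H.fitRows_pos hmu
  have hmu' := H.fitCols_pos hlam
  have hswap : ∀ m : Fin l → ℝ, ∑ u, lam u * ∑ v, I u v * m v = ∑ v, m v * ∑ u, I u v * lam u := by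
    intro m
    simp only [Finset.mul_sum]
    rw [Finset.sum_comm]
    exact Finset.sum_congr rfl fun v _ => Finset.sum_congr rfl fun u _ => by ring
  -- The array `I lam mu'` has column sums `gap y`, hence total mass 1, as does `gap x`.
  have hrow : ∑ u, gap x u * ((∑ v, I u v * mu' v) / (∑ v, I u v * mu v) - 1) = 0 := by
    have h1 : ∀ u, gap x u * ((∑ v, I u v * mu' v) / (∑ v, I u v * mu v) - 1)
        = lam u * (∑ v, I u v * mu' v) - gap x u := fun u => by
      simp only [hlam_def, fitRows]; ring
    have h2 : ∀ v, mu' v * ∑ u, I u v * lam u = gap y v := fun v => by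
      rw [hmu'_def, fitCols, div_mul_cancel₀ _ (H.col_pos hlam v).ne']
    simp only [h1, Finset.sum_sub_distrib]
    rw [hswap, H.hx.sum_gap, Finset.sum_congr rfl fun v _ => h2 v, H.hy.sum_gap, sub_self]
  -- Likewise `I lam mu` has row sums `gap x`, hence total mass 1.
  have hcol : ∑ v, gap y v * (mu v / mu' v - 1) = 0 := by
    have h1 : ∀ v, gap y v * (mu v / mu' v - 1) = mu v * (∑ u, I u v * lam u) - gap y v := by
      intro v
      have := (H.hy.gap_pos v).ne'
      have := (H.col_pos hlam v).ne'
      simp only [hmu'_def, fitCols]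
      field_simp
    have h2 : ∀ u, lam u * ∑ v, I u v * mu v = gap x u := fun u => by
      rw [hlam_def, fitRows, div_mul_cancel₀ _ (H.row_pos hmu u).ne']
    simp only [h1, Finset.sum_sub_distrib]
    rw [← hswap, H.hy.sum_gap, Finset.sum_congr rfl fun u _ => h2 u, H.hx.sum_gap, sub_self]
  have hlog : ∑ u, gap x u * Real.log ((∑ v, I u v * mu' v) / (∑ v, I u v * mu v)) ≤ 0 := by
    rw [← hrow]
    exact Finset.sum_le_sum fun u _ => mul_le_mul_of_nonneg_left
      (Real.log_le_sub_one_of_pos (div_pos (H.row_pos hmu' u) (H.row_pos hmu u)))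
      (H.hx.gap_pos u).le
  have e1 : ∀ u, gap x u * Real.log ((∑ v, I u v * mu' v) / (∑ v, I u v * mu v))
      = gap x u * Real.log (∑ v, I u v * mu' v) - gap x u * Real.log (∑ v, I u v * mu v) :=
    fun u => by rw [Real.log_div (H.row_pos hmu' u).ne' (H.row_pos hmu u).ne', mul_sub]
  have e2 : ∀ v, gap y v * (mu v / mu' v - 1 - Real.log (mu v / mu' v))
      = gap y v * (mu v / mu' v - 1) - gap y v * Real.log (mu v)
        + gap y v * Real.log (mu' v) :=
    fun v => by rw [Real.log_div (hmu v).ne' (hmu' v).ne']; ring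
  simp only [e1, Finset.sum_sub_distrib] at hlog
  simp only [dualPotential, e2, Finset.sum_sub_distrib, Finset.sum_add_distrib, hcol]
  linarith

theorem fit_deficit_nonneg (H : Fittable x y I) {mu : Fin l → ℝ} (hmu : ∀ v, 0 < mu v) (v : Fin l) :
    0 ≤ gap y v * (mu v / fitCols y I (fitRows x I mu) v - 1
      - Real.log (mu v / fitCols y I (fitRows x I mu) v)) :=
  mul_nonneg (H.hy.gap_pos v).le (sub_nonneg.2 (Real.log_le_sub_one_of_pos
    (div_pos (hmu v) (H.fitCols_pos (H.fitRows_pos hmu) v))))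

theorem dualPotential_fit_le (H : Fittable x y I) {mu : Fin l → ℝ} (hmu : ∀ v, 0 < mu v) :
    dualPotential x y I (fitCols y I (fitRows x I mu)) ≤ dualPotential x y I mu := by
  have h1 := H.dualPotential_fit_add_le hmu
  have h2 := Finset.sum_nonneg fun v (_ : v ∈ Finset.univ) => H.fit_deficit_nonneg hmu v
  linarith

/-- A vanishing decrease kills every term of the deficit, and `log z = z - 1` only at `z = 1`. -/
theorem fit_eq_of_dualPotential_eq (H : Fittable x y I) {mu : Fin l → ℝ} (hmu : ∀ v, 0 < mu v)
    (h : dualPotential x y I (fitCols y I (fitRows x I mu)) = dualPotential x y I mu) :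
    fitCols y I (fitRows x I mu) = mu := by
  have h1 := H.dualPotential_fit_add_le hmu
  have h2 : ∑ v, gap y v * (mu v / fitCols y I (fitRows x I mu) v - 1
      - Real.log (mu v / fitCols y I (fitRows x I mu) v)) = 0 :=
    le_antisymm (by linarith) (Finset.sum_nonneg fun v _ => H.fit_deficit_nonneg hmu v)
  rw [Finset.sum_eq_zero_iff_of_nonneg fun v _ => H.fit_deficit_nonneg hmu v] at h2
  ext v
  have hpos := H.fitCols_pos (H.fitRows_pos hmu) v
  have h3 := (mul_eq_zero.1 (h2 v (Finset.mem_univ v))).resolve_left (H.hy.gap_pos v).ne'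
  by_contra hne
  have h4 := Real.log_lt_sub_one_of_pos (div_pos (hmu v) hpos)
    (fun h5 => hne ((div_eq_one_iff_eq hpos.ne').1 h5).symm)
  linarith

/-- Convergence of iterative proportional fitting, given that some scaling exists. -/
theorem exists_tendsto_sinkhorn (H : Fittable x y I) (hsc : ∃ lam mu, IsScaling x y I lam mu) :
    ∃ lam mu, IsScaling x y I lam mu ∧
      Filter.Tendsto (sinkhornLam x y I) Filter.atTop (nhds lam) ∧
      Filter.Tendsto (sinkhornMu x y I) Filter.atTop (nhds mu) := by
  obtain ⟨lam₀, mu₀, h₀⟩ := hsc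
  have hmu₀ := h₀.mu_pos
  have hfix₀ : fitCols y I (fitRows x I mu₀) = mu₀ := by
    obtain ⟨h1, h2⟩ := (H.isScaling_iff hmu₀ h₀.lam_pos).1 h₀
    rw [← h1, ← h2]
  -- the iterates stay in a compact box of positive vectors
  obtain ⟨c, hc, hc'⟩ : ∃ c : ℝ, 0 < c ∧ ∀ v, c * mu₀ v ≤ 1 := by
    have hpos : 0 < 1 + ∑ v, mu₀ v :=
      add_pos_of_pos_of_nonneg one_pos (Finset.sum_nonneg fun v _ => (hmu₀ v).le)
    refine ⟨(1 + ∑ v, mu₀ v)⁻¹, inv_pos.2 hpos, fun v => ?_⟩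
    rw [inv_mul_le_iff₀ hpos, mul_one]
    have := Finset.single_le_sum (f := mu₀) (fun v _ => (hmu₀ v).le) (Finset.mem_univ v)
    linarith
  obtain ⟨d, hd⟩ : ∃ d : ℝ, ∀ v, 1 ≤ d * mu₀ v := by
    refine ⟨∑ v, (mu₀ v)⁻¹, fun v => ?_⟩
    have := Finset.single_le_sum (f := fun v => (mu₀ v)⁻¹) (fun v _ => (inv_pos.2 (hmu₀ v)).le)
      (Finset.mem_univ v)
    calc (1 : ℝ) = (mu₀ v)⁻¹ * mu₀ v := (inv_mul_cancel₀ (hmu₀ v).ne').symm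
      _ ≤ _ := mul_le_mul_of_nonneg_right this (hmu₀ v).le
  have hbox : ∀ n, sinkhornMu x y I n ∈
      Set.pi univ fun v => Icc (c * mu₀ v) (d * mu₀ v) := fun n v _ =>
    H.sinkhornMu_mem_box hmu₀ hfix₀ hc (n := 0) (fun v => ⟨hc' v, hd v⟩) (Nat.zero_le n) v
  obtain ⟨mu, hmubox, φ, hφ, hlim⟩ :=
    (isCompact_univ_pi fun v => isCompact_Icc).tendsto_subseq hbox
  have hmu : ∀ v, 0 < mu v := fun v =>
    (mul_pos hc (hmu₀ v)).trans_le (hmubox v (mem_univ v)).1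
  -- by monotonicity of the potential, the limit point is a fixed point
  have hfit : ContinuousAt (fun m => fitCols y I (fitRows x I m)) mu :=
    ContinuousAt.comp (g := fitCols y I) (H.continuousAt_fitCols (H.fitRows_pos hmu))
      (H.continuousAt_fitRows hmu)
  have hanti : Antitone fun n => dualPotential x y I (sinkhornMu x y I n) :=
    antitone_nat_of_succ_le fun n => H.dualPotential_fit_le (H.sinkhornMu_pos n)
  have hpot := (tendsto_iff_tendsto_subseq_of_antitone hanti hφ.tendsto_atTop).2
    ((H.continuousAt_dualPotential hmu).tendsto.comp hlim)
  -- The shifted subsequence has the same limiting potential, which by continuity is also the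
  -- potential one step after `mu`. So a step from `mu` does not lower the potential.
  have hpot1 : Filter.Tendsto (fun n => dualPotential x y I (sinkhornMu x y I (φ n + 1)))
      Filter.atTop (nhds (dualPotential x y I mu)) :=
    hpot.comp ((Filter.tendsto_add_atTop_nat 1).comp hφ.tendsto_atTop)
  have hpot2 : Filter.Tendsto (fun n => dualPotential x y I (sinkhornMu x y I (φ n + 1)))
      Filter.atTop (nhds (dualPotential x y I (fitCols y I (fitRows x I mu)))) :=
    (H.continuousAt_dualPotential (H.fitCols_pos (H.fitRows_pos hmu))).tendsto.comp
      (hfit.tendsto.comp hlim)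
  have hfix := H.fit_eq_of_dualPotential_eq hmu (tendsto_nhds_unique hpot2 hpot1)
  -- Only a subsequence is known to converge, but once an iterate lies between `(1 - ε) mu` and `(1
  -- + ε) mu`, all later ones do.
  have hconv : Filter.Tendsto (sinkhornMu x y I) Filter.atTop (nhds mu) := by
    have hbd : ∀ ε : ℝ, 0 < ε → ε < 1 → ∃ N, ∀ n ≥ N, ∀ v,
        (1 - ε) * mu v ≤ sinkhornMu x y I n v ∧ sinkhornMu x y I n v ≤ (1 + ε) * mu v := by
      intro ε hε hε1
      have hev : ∀ v, ∀ᶠ n in Filter.atTop, (1 - ε) * mu v ≤ sinkhornMu x y I (φ n) v ∧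
          sinkhornMu x y I (φ n) v ≤ (1 + ε) * mu v := by
        intro v
        refine (tendsto_pi_nhds.1 hlim v).eventually (Icc_mem_nhds ?_ ?_) <;> nlinarith [hmu v]
      obtain ⟨n, hn⟩ := (Filter.eventually_all.2 hev).exists
      exact ⟨φ n, fun m hm => H.sinkhornMu_mem_box hmu hfix (by linarith) hn hm⟩
    refine tendsto_pi_nhds.2 fun v => Metric.tendsto_atTop.2 fun ε hε => ?_
    have hv := hmu v
    -- The bound `1 / 2` keeps the lower multiple of `mu` positive; the other makes the error in
    -- coordinate `v` at most `ε / 2`.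
    obtain ⟨N, hN⟩ := hbd (min (1 / 2) (ε / (2 * mu v)))
      (lt_min (by norm_num) (by positivity)) ((min_le_left _ _).trans_lt (by norm_num))
    refine ⟨N, fun n hn => ?_⟩
    have h1 : min (1 / 2) (ε / (2 * mu v)) * mu v ≤ ε / 2 := by
      calc _ ≤ ε / (2 * mu v) * mu v := mul_le_mul_of_nonneg_right (min_le_right _ _) hv.le
        _ = ε / 2 := by field_simp
    obtain ⟨h2, h3⟩ := hN n hn v
    rw [Real.dist_eq, abs_lt]
    constructor <;> linarith
  exact ⟨fitRows x I mu, mu, (H.isScaling_iff hmu (H.fitRows_pos hmu)).2 ⟨rfl, hfix.symm⟩,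
    (H.continuousAt_fitRows hmu).tendsto.comp hconv, hconv⟩

end Fittable

end Scaling

/-! ### Step densities on the grid and their height functions. -/

section Step

variable {k l : ℕ} {x : Fin (k + 1) → ℝ} {y : Fin (l + 1) → ℝ} {I : Fin k → Fin l → ℝ}

theorem IsSubdivision.mem_Icc (hx : IsSubdivision x) (i : Fin (k + 1)) : x i ∈ Icc (0 : ℝ) 1 :=
  ⟨hx.1 ▸ hx.2.2.monotone (Fin.zero_le i), hx.2.1 ▸ hx.2.2.monotone (Fin.le_last i)⟩

theorem IsSubdivision.castSucc_lt_succ (hx : IsSubdivision x) (u : Fin k) :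
    x u.castSucc < x u.succ :=
  hx.2.2 u.castSucc_lt_succ

/-- The length of the part of the `u`-th interval that lies below `s`. -/
noncomputable def lengthBelow (x : Fin (k + 1) → ℝ) (u : Fin k) (s : ℝ) : ℝ :=
  min s (x u.succ) - min s (x u.castSucc)

theorem lengthBelow_mono (hx : IsSubdivision x) (u : Fin k) : Monotone (lengthBelow x u) := by
  intro s t hst
  have := hx.castSucc_lt_succ u
  simp only [lengthBelow]
  rcases le_total s (x u.succ) with h1 | h1 <;> rcases le_total s (x u.castSucc) with h2 | h2 <;>
  rcases le_total t (x u.succ) with h3 | h3 <;> rcases le_total t (x u.castSucc) with h4 | h4 <;>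
  simp only [h1, h2, h3, h4, min_eq_left, min_eq_right] <;> linarith

theorem lengthBelow_of_le (hx : IsSubdivision x) {u : Fin k} {s : ℝ} (h : s ≤ x u.castSucc) :
    lengthBelow x u s = 0 := by
  rw [lengthBelow, min_eq_left h, min_eq_left (h.trans (hx.castSucc_lt_succ u).le), sub_self]

theorem lengthBelow_of_ge (hx : IsSubdivision x) {u : Fin k} {s : ℝ} (h : x u.succ ≤ s) :
    lengthBelow x u s = gap x u := by
  rw [lengthBelow, min_eq_right h, min_eq_right ((hx.castSucc_lt_succ u).le.trans h), gap]

theorem lengthBelow_zero (hx : IsSubdivision x) (u : Fin k) : lengthBelow x u 0 = 0 :=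
  lengthBelow_of_le hx (hx.mem_Icc _).1

theorem lengthBelow_one (hx : IsSubdivision x) (u : Fin k) : lengthBelow x u 1 = gap x u :=
  lengthBelow_of_ge hx (hx.mem_Icc _).2

theorem lengthBelow_nonneg (hx : IsSubdivision x) (u : Fin k) {s : ℝ} (hs : 0 ≤ s) :
    0 ≤ lengthBelow x u s :=
  lengthBelow_zero hx u ▸ lengthBelow_mono hx u hs

theorem lengthBelow_le_gap (hx : IsSubdivision x) (u : Fin k) {s : ℝ} (hs : s ≤ 1) :
    lengthBelow x u s ≤ gap x u :=
  lengthBelow_one hx u ▸ lengthBelow_mono hx u hs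

theorem sum_lengthBelow (hx : IsSubdivision x) {s : ℝ} (hs : s ∈ Icc (0 : ℝ) 1) :
    ∑ u, lengthBelow x u s = s := by
  simp only [lengthBelow]
  rw [sum_fin_succ_sub_castSucc fun i => min s (x i), hx.1, hx.2.1, min_eq_left hs.2,
    min_eq_right hs.1, sub_zero]

theorem lengthBelow_succ_sub_castSucc (hx : IsSubdivision x) {u w : Fin k} (h : u ≠ w) :
    lengthBelow x u (x w.succ) - lengthBelow x u (x w.castSucc) = 0 := by
  rcases lt_or_gt_of_ne h with h | h
  · rw [lengthBelow_of_ge hx (hx.2.2.monotone (Fin.succ_le_succ_iff.2 h.le)),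
      lengthBelow_of_ge hx (hx.2.2.monotone (Fin.succ_le_castSucc_iff.2 h)), sub_self]
  · rw [lengthBelow_of_le hx (hx.2.2.monotone (Fin.succ_le_castSucc_iff.2 h)),
      lengthBelow_of_le hx (hx.2.2.monotone (Fin.castSucc_le_castSucc_iff.2 h.le)), sub_self]

theorem volume_real_Ioo_inter_Icc_zero (hx : IsSubdivision x) (u : Fin k) (t : ℝ) :
    volume.real (Ioo (x u.castSucc) (x u.succ) ∩ Icc 0 t) = lengthBelow x u t := by
  have h0 := (hx.mem_Icc u.castSucc).1
  have hlt := hx.castSucc_lt_succ u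
  have hae : (Ioo (x u.castSucc) (x u.succ) ∩ Icc 0 t : Set ℝ) =ᵐ[volume]
      (Ioc (x u.castSucc) (min (x u.succ) t) : Set ℝ) := by
    have h1 : (Ioc (x u.castSucc) (min (x u.succ) t) : Set ℝ)
        = Ioc (x u.castSucc) (x u.succ) ∩ Icc 0 t := by
      ext z
      simp only [mem_Ioc, mem_inter_iff, mem_Icc, le_min_iff]
      constructor
      · rintro ⟨h, h', h''⟩; exact ⟨⟨h, h'⟩, h0.trans h.le, h''⟩
      · rintro ⟨⟨h, h'⟩, -, h''⟩; exact ⟨h, h', h''⟩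
    rw [h1]
    exact ae_eq_set_inter Ioo_ae_eq_Ioc Filter.EventuallyEq.rfl
  rw [measureReal_congr hae, Real.volume_real_Ioc, lengthBelow]
  rcases le_total t (x u.succ) with h1 | h1 <;> rcases le_total t (x u.castSucc) with h2 | h2 <;>
  simp only [h1, h2, min_eq_left, min_eq_right] <;>
  first
    | (exfalso; linarith)
    | (rw [max_eq_left (by linarith)])
    | (rw [max_eq_right (by linarith)]; linarith)

theorem volume_real_Ioo_inter_Icc_one (hx : IsSubdivision x) (u : Fin k) (s : ℝ) :
    volume.real (Ioo (x u.castSucc) (x u.succ) ∩ Icc s 1) = gap x u - lengthBelow x u s := by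
  have h0 := (hx.mem_Icc u.succ).2
  have hlt := hx.castSucc_lt_succ u
  have hae : (Ioo (x u.castSucc) (x u.succ) ∩ Icc s 1 : Set ℝ) =ᵐ[volume]
      (Ico (max (x u.castSucc) s) (x u.succ) : Set ℝ) := by
    have h1 : (Ico (max (x u.castSucc) s) (x u.succ) : Set ℝ)
        = Ico (x u.castSucc) (x u.succ) ∩ Icc s 1 := by
      ext z
      simp only [mem_Ico, mem_inter_iff, mem_Icc, max_le_iff]
      constructor
      · rintro ⟨⟨h, h'⟩, h''⟩; exact ⟨⟨h, h''⟩, h', h''.le.trans h0⟩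
      · rintro ⟨⟨h, h'⟩, h'', -⟩; exact ⟨⟨h, h''⟩, h'⟩
    rw [h1]
    exact ae_eq_set_inter Ioo_ae_eq_Ico Filter.EventuallyEq.rfl
  rw [measureReal_congr hae, Real.volume_real_Ico, lengthBelow, gap]
  rcases le_total s (x u.succ) with h1 | h1 <;> rcases le_total s (x u.castSucc) with h2 | h2 <;>
  simp only [h1, h2, min_eq_left, min_eq_right, max_eq_left, max_eq_right] <;>
  first
    | (exfalso; linarith)
    | (rw [max_eq_left (by linarith)]; linarith)
    | (rw [max_eq_right (by linarith)]; linarith)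

theorem measurableSet_openRect (u : Fin k) (v : Fin l) : MeasurableSet (openRect x y u v) :=
  measurableSet_Ioo.prod measurableSet_Ioo

theorem measurableSet_unitSquare : MeasurableSet unitSquare :=
  measurableSet_Icc.prod measurableSet_Icc

theorem openRect_subset_unitSquare (hx : IsSubdivision x) (hy : IsSubdivision y) (u : Fin k)
    (v : Fin l) : openRect x y u v ⊆ unitSquare := fun _ hp =>
  ⟨⟨(hx.mem_Icc _).1.trans hp.1.1.le, hp.1.2.le.trans (hx.mem_Icc _).2⟩,
    ⟨(hy.mem_Icc _).1.trans hp.2.1.le, hp.2.2.le.trans (hy.mem_Icc _).2⟩⟩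

theorem volume_real_openRect (hx : IsSubdivision x) (hy : IsSubdivision y) (u : Fin k)
    (v : Fin l) : volume.real (openRect x y u v) = gap x u * gap y v := by
  rw [openRect, Measure.volume_eq_prod, measureReal_prod_prod,
    Real.volume_real_Ioo_of_le (hx.castSucc_lt_succ u).le,
    Real.volume_real_Ioo_of_le (hy.castSucc_lt_succ v).le, gap, gap]

theorem volume_real_unitSquare : volume.real unitSquare = 1 := by
  rw [unitSquare, Measure.volume_eq_prod, measureReal_prod_prod,
    Real.volume_real_Icc_of_le zero_le_one]
  norm_num

theorem volume_unitSquare_ne_top : volume unitSquare ≠ ⊤ :=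
  (isCompact_Icc.prod isCompact_Icc).measure_lt_top.ne

theorem IsSubdivision.eq_of_mem_Ioo (hx : IsSubdivision x) {u w : Fin k} {s : ℝ}
    (hu : s ∈ Ioo (x u.castSucc) (x u.succ)) (hw : s ∈ Ioo (x w.castSucc) (x w.succ)) : u = w := by
  by_contra h
  rcases lt_or_gt_of_ne h with h | h
  · have := hx.2.2.monotone (Fin.succ_le_castSucc_iff.2 h)
    linarith [hu.2, hw.1]
  · have := hx.2.2.monotone (Fin.succ_le_castSucc_iff.2 h)
    linarith [hu.1, hw.2]

theorem eq_of_mem_openRect (hx : IsSubdivision x) (hy : IsSubdivision y) {u u' : Fin k}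
    {v v' : Fin l} {p : ℝ × ℝ} (h : p ∈ openRect x y u v) (h' : p ∈ openRect x y u' v') :
    u = u' ∧ v = v' :=
  ⟨hx.eq_of_mem_Ioo h.1 h'.1, hy.eq_of_mem_Ioo h.2 h'.2⟩

/-- Almost every point of the unit square lies in one of the open rectangles. -/
theorem ae_mem_openRect (hx : IsSubdivision x) (hy : IsSubdivision y) :
    ∀ᵐ p ∂volume.restrict unitSquare, ∃ u v, p ∈ openRect x y u v := by
  have hsub : (⋃ q : Fin k × Fin l, openRect x y q.1 q.2) ⊆ unitSquare :=
    iUnion_subset fun q => openRect_subset_unitSquare hx hy q.1 q.2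
  -- The rectangles are disjoint and their areas add up to `(∑ gap x)(∑ gap y) = 1`, so they fill
  -- the square up to a null set.
  have hvol : volume.real (⋃ q : Fin k × Fin l, openRect x y q.1 q.2) = 1 := by
    rw [measureReal_iUnion_fintype
      (fun q q' hq => Set.disjoint_left.2 fun p hp hp' => hq (Prod.ext
        (eq_of_mem_openRect hx hy hp hp').1 (eq_of_mem_openRect hx hy hp hp').2))
      (fun q => measurableSet_openRect q.1 q.2)
      (fun q => measure_ne_top_of_subset (openRect_subset_unitSquare hx hy q.1 q.2)
        volume_unitSquare_ne_top), Fintype.sum_prod_type]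
    simp only [volume_real_openRect hx hy, ← Finset.mul_sum, hy.sum_gap, mul_one, hx.sum_gap]
  have hae : (⋃ q : Fin k × Fin l, openRect x y q.1 q.2 : Set (ℝ × ℝ)) =ᵐ[volume] unitSquare := by
    have hmeas : MeasurableSet (⋃ q : Fin k × Fin l, openRect x y q.1 q.2) :=
      MeasurableSet.iUnion fun q => measurableSet_openRect q.1 q.2
    refine ae_eq_of_subset_of_measure_ge hsub ?_ hmeas.nullMeasurableSet volume_unitSquare_ne_top
    refine (ENNReal.toReal_le_toReal volume_unitSquare_ne_top
      (measure_ne_top_of_subset hsub volume_unitSquare_ne_top)).1 ?_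
    exact (volume_real_unitSquare.trans hvol.symm).le
  rw [ae_restrict_iff' measurableSet_unitSquare]
  filter_upwards [hae] with p hp hpS
  obtain ⟨q, hq⟩ := mem_iUnion.1 (hp.mpr hpS)
  exact ⟨q.1, q.2, hq⟩

/-- The function with the value `c u v` on the `(u, v)`-th open rectangle and zero elsewhere. -/
noncomputable def stepFun (x : Fin (k + 1) → ℝ) (y : Fin (l + 1) → ℝ) (c : Fin k → Fin l → ℝ)
    (p : ℝ × ℝ) : ℝ :=
  ∑ u, ∑ v, (openRect x y u v).indicator (fun _ => c u v) p

theorem stepFun_of_mem (hx : IsSubdivision x) (hy : IsSubdivision y) (c : Fin k → Fin l → ℝ)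
    {u : Fin k} {v : Fin l} {p : ℝ × ℝ} (hp : p ∈ openRect x y u v) :
    stepFun x y c p = c u v := by
  rw [stepFun, Finset.sum_eq_single u, Finset.sum_eq_single v, indicator_of_mem hp]
  · exact fun v' _ hv => indicator_of_notMem (fun h => hv (eq_of_mem_openRect hx hy h hp).2) _
  · simp
  · exact fun u' _ hu => Finset.sum_eq_zero fun v' _ =>
      indicator_of_notMem (fun h => hu (eq_of_mem_openRect hx hy h hp).1) _
  · simp

theorem integrableOn_mul_stepFun {f : ℝ × ℝ → ℝ} {S : Set (ℝ × ℝ)} (hf : IntegrableOn f S)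
    (c : Fin k → Fin l → ℝ) : IntegrableOn (fun p => f p * stepFun x y c p) S := by
  simp only [stepFun, Finset.mul_sum]
  refine integrable_finsetSum _ fun u _ => integrable_finsetSum _ fun v _ => ?_
  refine ((Integrable.mul_const hf (c u v)).indicator
    (measurableSet_openRect (x := x) (y := y) u v)).congr
    (Filter.Eventually.of_forall fun p => ?_)
  by_cases hp : p ∈ openRect x y u v <;> simp [hp]

theorem setIntegral_mul_stepFun {f : ℝ × ℝ → ℝ} {S : Set (ℝ × ℝ)} (hf : IntegrableOn f S)
    (c : Fin k → Fin l → ℝ) :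
    ∫ p in S, f p * stepFun x y c p
      = ∑ u, ∑ v, c u v * ∫ p in openRect x y u v ∩ S, f p := by
  have hind : ∀ (u : Fin k) (v : Fin l) (p : ℝ × ℝ),
      f p * (openRect x y u v).indicator (fun _ => c u v) p
        = (openRect x y u v).indicator (fun p => f p * c u v) p := by
    intro u v p
    by_cases hp : p ∈ openRect x y u v <;> simp [hp]
  have hint : ∀ u v, Integrable ((openRect x y u v).indicator (fun p => f p * c u v))
      (volume.restrict S) := fun u v =>
    (Integrable.mul_const hf (c u v)).indicator (measurableSet_openRect u v)
  simp only [stepFun, Finset.mul_sum, hind]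
  rw [integral_finsetSum _ fun u _ => integrable_finsetSum _ fun v _ => hint u v]
  refine Finset.sum_congr rfl fun u _ => ?_
  rw [integral_finsetSum _ fun v _ => hint u v]
  refine Finset.sum_congr rfl fun v _ => ?_
  rw [integral_indicator (measurableSet_openRect u v),
    Measure.restrict_restrict (measurableSet_openRect u v), integral_mul_const, mul_comm]

theorem integrableOn_stepFun {S : Set (ℝ × ℝ)} (hS : S ⊆ unitSquare) (c : Fin k → Fin l → ℝ) :
    IntegrableOn (stepFun x y c) S := by
  have h : IntegrableOn (fun _ : ℝ × ℝ => (1 : ℝ)) S :=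
    integrableOn_const (measure_ne_top_of_subset hS volume_unitSquare_ne_top)
  simpa using integrableOn_mul_stepFun (x := x) (y := y) h c

theorem setIntegral_stepFun {S : Set (ℝ × ℝ)} (hS : S ⊆ unitSquare) (c : Fin k → Fin l → ℝ) :
    ∫ p in S, stepFun x y c p = ∑ u, ∑ v, c u v * volume.real (openRect x y u v ∩ S) := by
  have h : IntegrableOn (fun _ : ℝ × ℝ => (1 : ℝ)) S :=
    integrableOn_const (measure_ne_top_of_subset hS volume_unitSquare_ne_top)
  have := setIntegral_mul_stepFun (x := x) (y := y) h c
  simpa using this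

/-- The height function of the permuton with density `stepFun x y c`. -/
noncomputable def stepHeight (x : Fin (k + 1) → ℝ) (y : Fin (l + 1) → ℝ) (c : Fin k → Fin l → ℝ)
    (p : ℝ × ℝ) : ℝ :=
  ∑ u, ∑ v, c u v * ((gap x u - lengthBelow x u p.1) * lengthBelow y v p.2)

theorem isDensity_stepHeight (hx : IsSubdivision x) (hy : IsSubdivision y)
    {c : Fin k → Fin l → ℝ} (hc : ∀ u v, 0 ≤ c u v) :
    IsDensity (stepHeight x y c) (stepFun x y c) where
  integrableOn := integrableOn_stepFun subset_rfl c
  nonneg _ _ := Finset.sum_nonneg fun u _ => Finset.sum_nonneg fun v _ =>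
    indicator_nonneg (fun _ _ => hc u v) _
  eq_integral s hs t ht := by
    have hsub : Icc s 1 ×ˢ Icc 0 t ⊆ unitSquare :=
      prod_mono (Icc_subset_Icc_left hs.1) (Icc_subset_Icc_right ht.2)
    rw [setIntegral_stepFun hsub, stepHeight]
    refine Finset.sum_congr rfl fun u _ => Finset.sum_congr rfl fun v _ => ?_
    rw [openRect, prod_inter_prod, Measure.volume_eq_prod, measureReal_prod_prod,
      volume_real_Ioo_inter_Icc_one hx, volume_real_Ioo_inter_Icc_zero hy]

theorem stepHeight_sub_left (c : Fin k → Fin l → ℝ) (s₁ s₂ t : ℝ) :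
    stepHeight x y c (s₁, t) - stepHeight x y c (s₂, t)
      = ∑ u, ∑ v, c u v * ((lengthBelow x u s₂ - lengthBelow x u s₁) * lengthBelow y v t) := by
  simp only [stepHeight, ← Finset.sum_sub_distrib]
  exact Finset.sum_congr rfl fun u _ => Finset.sum_congr rfl fun v _ => by ring

theorem stepHeight_sub_right (c : Fin k → Fin l → ℝ) (s t₁ t₂ : ℝ) :
    stepHeight x y c (s, t₂) - stepHeight x y c (s, t₁)
      = ∑ u, ∑ v, c u v * ((gap x u - lengthBelow x u s)
          * (lengthBelow y v t₂ - lengthBelow y v t₁)) := by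
  simp only [stepHeight, ← Finset.sum_sub_distrib]
  exact Finset.sum_congr rfl fun u _ => Finset.sum_congr rfl fun v _ => by ring

theorem stepHeight_rectangle (c : Fin k → Fin l → ℝ) (s₁ s₂ t₁ t₂ : ℝ) :
    stepHeight x y c (s₁, t₁) + stepHeight x y c (s₂, t₂) - stepHeight x y c (s₁, t₂)
      - stepHeight x y c (s₂, t₁)
      = -∑ u, ∑ v, c u v * ((lengthBelow x u s₂ - lengthBelow x u s₁)
          * (lengthBelow y v t₂ - lengthBelow y v t₁)) := by
  simp only [stepHeight, ← Finset.sum_sub_distrib, ← Finset.sum_add_distrib,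
    ← Finset.sum_neg_distrib]
  exact Finset.sum_congr rfl fun u _ => Finset.sum_congr rfl fun v _ => by ring

/-- `hrow` says that the first marginal has density 1, so full-height strips of widths `d u` have
total mass `∑ d u`. -/
theorem sum_mul_mul_eq_of_row {c : Fin k → Fin l → ℝ}
    (hrow : ∀ u, ∑ v, c u v * gap y v = 1) (d : Fin k → ℝ) :
    ∑ u, ∑ v, c u v * (d u * gap y v) = ∑ u, d u := by
  refine Finset.sum_congr rfl fun u _ => ?_
  simp only [mul_left_comm _ (d u), ← Finset.mul_sum, hrow, mul_one]

theorem sum_mul_mul_eq_of_col {c : Fin k → Fin l → ℝ}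
    (hcol : ∀ v, ∑ u, c u v * gap x u = 1) (d : Fin l → ℝ) :
    ∑ u, ∑ v, c u v * (gap x u * d v) = ∑ v, d v := by
  rw [Finset.sum_comm]
  refine Finset.sum_congr rfl fun v _ => ?_
  simp only [← mul_assoc, ← Finset.sum_mul, hcol, one_mul]

theorem lipschitzOnWith_one_of_le {f : ℝ → ℝ} {S : Set ℝ}
    (h : ∀ a ∈ S, ∀ b ∈ S, a ≤ b → |f a - f b| ≤ b - a) : LipschitzOnWith 1 f S := by
  refine LipschitzOnWith.of_dist_le_mul fun a ha b hb => ?_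
  rw [NNReal.coe_one, one_mul, Real.dist_eq, Real.dist_eq]
  rcases le_total a b with hab | hab
  · rw [abs_sub_comm a b, abs_of_nonneg (sub_nonneg.2 hab)]; exact h a ha b hb hab
  · rw [abs_sub_comm (f a), abs_of_nonneg (sub_nonneg.2 hab)]; exact h b hb a ha hab

/-- An increment of the height in one variable is the mass of part of a strip, bounded by the mass
of the whole strip, which is its width because the marginals are uniform. -/
theorem isHeightFunction_stepHeight (hx : IsSubdivision x) (hy : IsSubdivision y)
    {c : Fin k → Fin l → ℝ} (hc : ∀ u v, 0 ≤ c u v) (hrow : ∀ u, ∑ v, c u v * gap y v = 1)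
    (hcol : ∀ v, ∑ u, c u v * gap x u = 1) : IsHeightFunction (stepHeight x y c) where
  lipschitz_x t ht := by
    refine lipschitzOnWith_one_of_le fun s₁ h₁ s₂ h₂ h₁₂ => ?_
    have hd : ∀ u, 0 ≤ lengthBelow x u s₂ - lengthBelow x u s₁ := fun u =>
      sub_nonneg.2 (lengthBelow_mono hx u h₁₂)
    rw [stepHeight_sub_left, abs_of_nonneg (Finset.sum_nonneg fun u _ => Finset.sum_nonneg
      fun v _ => mul_nonneg (hc u v) (mul_nonneg (hd u) (lengthBelow_nonneg hy v ht.1)))]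
    calc _ ≤ ∑ u, ∑ v, c u v * ((lengthBelow x u s₂ - lengthBelow x u s₁) * gap y v) :=
          Finset.sum_le_sum fun u _ => Finset.sum_le_sum fun v _ =>
            mul_le_mul_of_nonneg_left (mul_le_mul_of_nonneg_left
              (lengthBelow_le_gap hy v ht.2) (hd u)) (hc u v)
      _ = s₂ - s₁ := by
          rw [sum_mul_mul_eq_of_row hrow, Finset.sum_sub_distrib, sum_lengthBelow hx h₁,
            sum_lengthBelow hx h₂]
  lipschitz_y s hs := by
    refine lipschitzOnWith_one_of_le fun t₁ h₁ t₂ h₂ h₁₂ => ?_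
    have hd : ∀ v, 0 ≤ lengthBelow y v t₂ - lengthBelow y v t₁ := fun v =>
      sub_nonneg.2 (lengthBelow_mono hy v h₁₂)
    rw [abs_sub_comm, stepHeight_sub_right, abs_of_nonneg (Finset.sum_nonneg fun u _ =>
      Finset.sum_nonneg fun v _ => mul_nonneg (hc u v)
        (mul_nonneg (sub_nonneg.2 (lengthBelow_le_gap hx u hs.2)) (hd v)))]
    calc _ ≤ ∑ u, ∑ v, c u v * (gap x u * (lengthBelow y v t₂ - lengthBelow y v t₁)) :=
          Finset.sum_le_sum fun u _ => Finset.sum_le_sum fun v _ =>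
            mul_le_mul_of_nonneg_left (mul_le_mul_of_nonneg_right
              (sub_le_self _ (lengthBelow_nonneg hx u hs.1)) (hd v)) (hc u v)
      _ = t₂ - t₁ := by
          rw [sum_mul_mul_eq_of_col hcol, Finset.sum_sub_distrib, sum_lengthBelow hy h₁,
            sum_lengthBelow hy h₂]
  rectangle s₁ s₂ t₁ t₂ _ hs _ _ ht _ := by
    rw [stepHeight_rectangle, neg_nonpos]
    exact Finset.sum_nonneg fun u _ => Finset.sum_nonneg fun v _ => mul_nonneg (hc u v)
      (mul_nonneg (sub_nonneg.2 (lengthBelow_mono hx u hs.le))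
        (sub_nonneg.2 (lengthBelow_mono hy v ht.le)))
  bottom s _ := by simp [stepHeight, lengthBelow_zero hy]
  top s hs := by
    simp only [stepHeight, lengthBelow_one hy]
    rw [sum_mul_mul_eq_of_row hrow, Finset.sum_sub_distrib, sum_lengthBelow hx hs, hx.sum_gap]
  left t ht := by
    simp only [stepHeight, lengthBelow_zero hx, sub_zero]
    rw [sum_mul_mul_eq_of_col hcol, sum_lengthBelow hy ht]
  right t _ := by simp [stepHeight, lengthBelow_one hx]

theorem stepHeight_mem_restrictedHeights (hx : IsSubdivision x) (hy : IsSubdivision y)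
    {c : Fin k → Fin l → ℝ} (hc : ∀ u v, 0 ≤ c u v) (hrow : ∀ u, ∑ v, c u v * gap y v = 1)
    (hcol : ∀ v, ∑ u, c u v * gap x u = 1) (hcI : ∀ u v, I u v = 0 → c u v = 0) :
    stepHeight x y c ∈ restrictedHeights x y I := by
  refine ⟨isHeightFunction_stepHeight hx hy hc hrow hcol, fun u v huv => ?_⟩
  have h := stepHeight_rectangle (x := x) (y := y) c (x u.castSucc) (x u.succ) (y v.castSucc)
    (y v.succ)
  have h0 : ∑ u', ∑ v', c u' v' *
      ((lengthBelow x u' (x u.succ) - lengthBelow x u' (x u.castSucc))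
        * (lengthBelow y v' (y v.succ) - lengthBelow y v' (y v.castSucc))) = 0 := by
    -- `lengthBelow` for one interval does not grow across another, so only the term `(u, v)` could
    -- survive, and there `c` is zero.
    refine Finset.sum_eq_zero fun u' _ => Finset.sum_eq_zero fun v' _ => ?_
    by_cases hu : u' = u
    · by_cases hv : v' = v
      · rw [hu, hv, hcI u v huv, zero_mul]
      · rw [lengthBelow_succ_sub_castSucc hy hv, mul_zero, mul_zero]
    · rw [lengthBelow_succ_sub_castSucc hx hu, zero_mul, mul_zero]
  rw [h0] at h
  linarith

end Step

/-! ### Grid masses of an arbitrary permuton density. -/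

/-- The mass of a rectangle in terms of the height function. -/
theorem IsDensity.setIntegral_Ioo_prod {h g : ℝ × ℝ → ℝ} (hg : IsDensity h g) {s₁ s₂ t₁ t₂ : ℝ}
    (hs₁ : 0 ≤ s₁) (hs : s₁ ≤ s₂) (hs₂ : s₂ ≤ 1) (ht₁ : 0 ≤ t₁) (ht : t₁ ≤ t₂) (ht₂ : t₂ ≤ 1) :
    ∫ p in Ioo s₁ s₂ ×ˢ Ioo t₁ t₂, g p
      = h (s₁, t₂) - h (s₂, t₂) - h (s₁, t₁) + h (s₂, t₁) := by
  -- `eq_integral` knows only corner rectangles; half-open strips split them disjointly, one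
  -- coordinate at a time.
  have hstrip : ∀ t ∈ Icc (0 : ℝ) 1,
      ∫ p in Ico s₁ s₂ ×ˢ Icc 0 t, g p = h (s₁, t) - h (s₂, t) := by
    intro t htm
    have hU : Icc s₁ 1 ×ˢ Icc 0 t = Ico s₁ s₂ ×ˢ Icc 0 t ∪ Icc s₂ 1 ×ˢ Icc 0 t := by
      rw [← union_prod, Ico_union_Icc_eq_Icc hs hs₂]
    have hS : ∀ a, 0 ≤ a → Icc a 1 ×ˢ Icc 0 t ⊆ unitSquare := fun a ha =>
      prod_mono (Icc_subset_Icc_left ha) (Icc_subset_Icc_right htm.2)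
    have := hS s₁ hs₁
    rw [hg.eq_integral s₁ ⟨hs₁, hs.trans hs₂⟩ t htm, hg.eq_integral s₂ ⟨hs₁.trans hs, hs₂⟩ t htm,
      hU, setIntegral_union, add_sub_cancel_right]
    · exact Set.disjoint_prod.2 (Or.inl (Set.disjoint_left.2 fun z hz hz' => hz.2.not_ge hz'.1))
    · exact measurableSet_Icc.prod measurableSet_Icc
    · exact hg.integrableOn.mono_set ((hU ▸ subset_union_left).trans this)
    · exact hg.integrableOn.mono_set (hS s₂ (hs₁.trans hs))
  have hU : Ico s₁ s₂ ×ˢ Icc 0 t₂ = Ico s₁ s₂ ×ˢ Icc 0 t₁ ∪ Ico s₁ s₂ ×ˢ Ioc t₁ t₂ := by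
    rw [← prod_union, Icc_union_Ioc_eq_Icc ht₁ ht]
  have hS : Ico s₁ s₂ ×ˢ Icc 0 t₂ ⊆ unitSquare :=
    prod_mono (Ico_subset_Icc_self.trans (Icc_subset_Icc hs₁ hs₂)) (Icc_subset_Icc_right ht₂)
  have h1 := hstrip t₂ ⟨ht₁.trans ht, ht₂⟩
  rw [hU, setIntegral_union, hstrip t₁ ⟨ht₁, ht.trans ht₂⟩] at h1
  · rw [setIntegral_congr_set (t := Ico s₁ s₂ ×ˢ Ioc t₁ t₂)]
    · linarith
    · rw [Measure.volume_eq_prod]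
      exact Measure.set_prod_ae_eq Ioo_ae_eq_Ico Ioo_ae_eq_Ioc
  · exact Set.disjoint_prod.2 (Or.inr (Set.disjoint_left.2 fun z hz hz' => hz'.1.not_ge hz.2))
  · exact measurableSet_Ico.prod measurableSet_Ioc
  · exact hg.integrableOn.mono_set ((hU ▸ subset_union_left).trans hS)
  · exact hg.integrableOn.mono_set ((hU ▸ subset_union_right).trans hS)

section Entropy

variable {k l : ℕ} {x : Fin (k + 1) → ℝ} {y : Fin (l + 1) → ℝ} {I : Fin k → Fin l → ℝ}

theorem IsDensity.setIntegral_openRect {h g : ℝ × ℝ → ℝ} (hg : IsDensity h g)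
    (hx : IsSubdivision x) (hy : IsSubdivision y) (u : Fin k) (v : Fin l) :
    ∫ p in openRect x y u v, g p = (h (x u.castSucc, y v.succ) - h (x u.succ, y v.succ))
      - (h (x u.castSucc, y v.castSucc) - h (x u.succ, y v.castSucc)) := by
  rw [openRect, hg.setIntegral_Ioo_prod (hx.mem_Icc _).1 (hx.castSucc_lt_succ u).le
    (hx.mem_Icc _).2 (hy.mem_Icc _).1 (hy.castSucc_lt_succ v).le (hy.mem_Icc _).2]
  ring

/-- The rectangle masses telescope along the row to boundary values of `h`. So the grid masses of
every permuton with a density have the prescribed marginals. -/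
theorem IsDensity.sum_row {h g : ℝ × ℝ → ℝ} (hg : IsDensity h g) (hh : IsHeightFunction h)
    (hx : IsSubdivision x) (hy : IsSubdivision y) (u : Fin k) :
    ∑ v, ∫ p in openRect x y u v, g p = gap x u := by
  simp only [hg.setIntegral_openRect hx hy]
  rw [sum_fin_succ_sub_castSucc fun j => h (x u.castSucc, y j) - h (x u.succ, y j), hy.1, hy.2.1,
    hh.top _ (hx.mem_Icc _), hh.top _ (hx.mem_Icc _), hh.bottom _ (hx.mem_Icc _),
    hh.bottom _ (hx.mem_Icc _), gap]
  ring

theorem IsDensity.sum_col {h g : ℝ × ℝ → ℝ} (hg : IsDensity h g) (hh : IsHeightFunction h)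
    (hx : IsSubdivision x) (hy : IsSubdivision y) (v : Fin l) :
    ∑ u, ∫ p in openRect x y u v, g p = gap y v := by
  have h1 : ∀ u : Fin k, ∫ p in openRect x y u v, g p
      = (h (x u.succ, y v.castSucc) - h (x u.succ, y v.succ))
        - (h (x u.castSucc, y v.castSucc) - h (x u.castSucc, y v.succ)) := fun u => by
    rw [hg.setIntegral_openRect hx hy]; ring
  simp only [h1]
  rw [sum_fin_succ_sub_castSucc fun j => h (x j, y v.castSucc) - h (x j, y v.succ), hx.1, hx.2.1,
    hh.right _ (hy.mem_Icc _), hh.right _ (hy.mem_Icc _), hh.left _ (hy.mem_Icc _),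
    hh.left _ (hy.mem_Icc _), gap]
  ring

theorem IsDensity.ae_eq_zero {h g : ℝ × ℝ → ℝ} (hg : IsDensity h g)
    (hh : h ∈ restrictedHeights x y I) (hx : IsSubdivision x) (hy : IsSubdivision y) :
    ∀ᵐ p ∂volume.restrict unitSquare, ∀ u v, I u v = 0 → p ∈ openRect x y u v → g p = 0 := by
  refine ae_all_iff.2 fun u => ae_all_iff.2 fun v => ?_
  by_cases huv : I u v = 0
  · have h0 : ∫ p in openRect x y u v, g p = 0 := by
      rw [hg.setIntegral_openRect hx hy]
      linarith [hh.2 u v huv]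
    have hsub := openRect_subset_unitSquare hx hy u v
    rw [setIntegral_eq_zero_iff_of_nonneg_ae ((ae_restrict_iff' (measurableSet_openRect u v)).2
      (Filter.Eventually.of_forall fun p hp => hg.nonneg p (hsub hp)))
      (hg.integrableOn.mono_set hsub)] at h0
    have h1 := (ae_restrict_iff' (measurableSet_openRect u v)).1 h0
    exact ae_restrict_of_ae (h1.mono fun p hp _ hpm => hp hpm)
  · exact Filter.Eventually.of_forall fun p h' => absurd h' huv

/-! ### The entropy inequality and its equality case. -/

/-- The non-negative difference between `z log z` and its tangent line at `c`. -/
theorem entropy_deficit {c z : ℝ} (hc : 0 < c) (hz : 0 ≤ z) :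
    0 ≤ c - z + z * Real.log z - z * Real.log c ∧
      (c - z + z * Real.log z - z * Real.log c = 0 → z = c) := by
  -- At `z = 0` the convention `0 log 0 = 0` leaves the deficit `c`; for `z > 0` it is `z` times `w
  -- - 1 - log w` with `w = c / z`.
  rcases hz.eq_or_lt with rfl | hz
  · refine ⟨by simpa using hc.le, fun h => ?_⟩
    simp at h
    exact h.symm
  · have e : c - z + z * Real.log z - z * Real.log c = z * (c / z - 1 - Real.log (c / z)) := by
      rw [Real.log_div hc.ne' hz.ne']; field_simp; ring
    rw [e]
    refine ⟨mul_nonneg hz.le (sub_nonneg.2 (Real.log_le_sub_one_of_pos (div_pos hc hz))),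
      fun h => ?_⟩
    by_contra hne
    have h1 := Real.log_lt_sub_one_of_pos (div_pos hc hz)
      (fun h5 => hne ((div_eq_one_iff_eq hz.ne').1 h5).symm)
    have h2 := (mul_eq_zero.1 h).resolve_left hz.ne'
    linarith

theorem energyIntegrand_zero (h g : ℝ × ℝ → ℝ) :
    energyIntegrand 0 h g = fun p => -(g p * Real.log (g p)) := by
  ext p; simp [energyIntegrand]

/-- The value of the density belonging to a scaling on the `(u, v)`-th rectangle. -/
noncomputable def scaledValue (x : Fin (k + 1) → ℝ) (y : Fin (l + 1) → ℝ) (I : Fin k → Fin l → ℝ)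
    (lam : Fin k → ℝ) (mu : Fin l → ℝ) (u : Fin k) (v : Fin l) : ℝ :=
  I u v * lam u * mu v / (gap x u * gap y v)

/-- The logarithm of `scaledValue`, extended additively to all rectangles. -/
noncomputable def scaledLog (x : Fin (k + 1) → ℝ) (y : Fin (l + 1) → ℝ)
    (lam : Fin k → ℝ) (mu : Fin l → ℝ) (u : Fin k) (v : Fin l) : ℝ :=
  Real.log (lam u / gap x u) + Real.log (mu v / gap y v)

/-- The energy of the permuton belonging to a scaling. -/
noncomputable def scaledEnergy (x : Fin (k + 1) → ℝ) (y : Fin (l + 1) → ℝ)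
    (lam : Fin k → ℝ) (mu : Fin l → ℝ) : ℝ :=
  -(∑ u, gap x u * Real.log (lam u / gap x u) + ∑ v, gap y v * Real.log (mu v / gap y v))

/-- The pointwise deficit in the entropy inequality for the density `g`. -/
noncomputable def entropyDeficit (x : Fin (k + 1) → ℝ) (y : Fin (l + 1) → ℝ)
    (I : Fin k → Fin l → ℝ) (lam : Fin k → ℝ) (mu : Fin l → ℝ) (g : ℝ × ℝ → ℝ) (p : ℝ × ℝ) : ℝ :=
  stepFun x y (scaledValue x y I lam mu) p - g p + g p * Real.log (g p)
    - g p * stepFun x y (scaledLog x y lam mu) p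

namespace IsScaling

variable {lam : Fin k → ℝ} {mu : Fin l → ℝ}

theorem sum_scaledValue_row (hsc : IsScaling x y I lam mu) (hx : IsSubdivision x)
    (hy : IsSubdivision y) (u : Fin k) : ∑ v, scaledValue x y I lam mu u v * gap y v = 1 := by
  have h : ∀ v, scaledValue x y I lam mu u v * gap y v = I u v * lam u * mu v / gap x u := by
    intro v
    have := (hy.gap_pos v).ne'
    have := (hx.gap_pos u).ne'
    rw [scaledValue]; field_simp
  simp only [h]
  rw [← Finset.sum_div, ← hsc.row_sum, div_self (hx.gap_pos u).ne']

theorem sum_scaledValue_col (hsc : IsScaling x y I lam mu) (hx : IsSubdivision x)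
    (hy : IsSubdivision y) (v : Fin l) : ∑ u, scaledValue x y I lam mu u v * gap x u = 1 := by
  have h : ∀ u, scaledValue x y I lam mu u v * gap x u = I u v * lam u * mu v / gap y v := by
    intro u
    have := (hy.gap_pos v).ne'
    have := (hx.gap_pos u).ne'
    rw [scaledValue]; field_simp
  simp only [h]
  rw [← Finset.sum_div, ← hsc.col_sum, div_self (hy.gap_pos v).ne']

theorem scaledValue_nonneg (hsc : IsScaling x y I lam mu) (hI : ∀ u v, I u v = 0 ∨ I u v = 1)
    (hx : IsSubdivision x) (hy : IsSubdivision y) (u : Fin k) (v : Fin l) :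
    0 ≤ scaledValue x y I lam mu u v := by
  have := hsc.lam_pos u
  have := hsc.mu_pos v
  have := hx.gap_pos u
  have := hy.gap_pos v
  rcases hI u v with h | h <;> rw [scaledValue, h] <;> positivity

theorem scaledValue_of_eq_one (hsc : IsScaling x y I lam mu) (hx : IsSubdivision x)
    (hy : IsSubdivision y) {u : Fin k} {v : Fin l} (h : I u v = 1) :
    0 < scaledValue x y I lam mu u v ∧
      Real.log (scaledValue x y I lam mu u v) = scaledLog x y lam mu u v := by
  have h1 := div_pos (hsc.lam_pos u) (hx.gap_pos u)
  have h2 := div_pos (hsc.mu_pos v) (hy.gap_pos v)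
  have e : scaledValue x y I lam mu u v = lam u / gap x u * (mu v / gap y v) := by
    rw [scaledValue, h, div_mul_div_comm, one_mul]
  rw [e, scaledLog, Real.log_mul h1.ne' h2.ne']
  exact ⟨mul_pos h1 h2, rfl⟩

theorem scaledHeight_mem (hsc : IsScaling x y I lam mu) (hI : ∀ u v, I u v = 0 ∨ I u v = 1)
    (hx : IsSubdivision x) (hy : IsSubdivision y) :
    stepHeight x y (scaledValue x y I lam mu) ∈ restrictedHeights x y I :=
  stepHeight_mem_restrictedHeights hx hy (hsc.scaledValue_nonneg hI hx hy)
    (hsc.sum_scaledValue_row hx hy) (hsc.sum_scaledValue_col hx hy)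
    fun u v h => by simp [scaledValue, h]

/-- Where `I = 1` this is the tangent-line inequality at the scaled value. Where `I = 0` both
densities vanish almost everywhere, so the value of `scaledLog` there is irrelevant. -/
theorem entropyDeficit_nonneg (hsc : IsScaling x y I lam mu) (hI : ∀ u v, I u v = 0 ∨ I u v = 1)
    (hx : IsSubdivision x) (hy : IsSubdivision y) {h g : ℝ × ℝ → ℝ} (hg : IsDensity h g)
    (hh : h ∈ restrictedHeights x y I) :
    ∀ᵐ p ∂volume.restrict unitSquare, 0 ≤ entropyDeficit x y I lam mu g p ∧
      (entropyDeficit x y I lam mu g p = 0 ↔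
        g p = stepFun x y (scaledValue x y I lam mu) p) := by
  filter_upwards [ae_mem_openRect hx hy, hg.ae_eq_zero hh hx hy,
    ae_restrict_mem measurableSet_unitSquare] with p ⟨u, v, hp⟩ hp0 hpS
  rw [entropyDeficit, stepFun_of_mem hx hy _ hp, stepFun_of_mem hx hy _ hp]
  rcases hI u v with h0 | h1
  · have hg0 := hp0 u v h0 hp
    have hc : scaledValue x y I lam mu u v = 0 := by simp [scaledValue, h0]
    simp [hg0, hc]
  · obtain ⟨hc, hlog⟩ := hsc.scaledValue_of_eq_one hx hy h1
    rw [← hlog]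
    obtain ⟨h2, h3⟩ := entropy_deficit hc (hg.nonneg p hpS)
    exact ⟨h2, h3, fun h => by rw [h]; ring⟩

theorem integrableOn_entropyDeficit {h g : ℝ × ℝ → ℝ} (hg : IsDensity h g)
    (hi : IntegrableOn (energyIntegrand 0 h g) unitSquare) :
    IntegrableOn (entropyDeficit x y I lam mu g) unitSquare := by
  have hi' : IntegrableOn (fun p => g p * Real.log (g p)) unitSquare := by
    rw [energyIntegrand_zero] at hi
    simpa using hi.neg
  exact (((integrableOn_stepFun subset_rfl _).sub hg.integrableOn).add hi').sub
    (integrableOn_mul_stepFun hg.integrableOn _)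

/-- Both densities have mass 1 and cancel. As `scaledLog` is a row term plus a column term, its
integral against `g` depends only on the marginals of `g`, hence not on `g`. -/
theorem setIntegral_energyIntegrand (hsc : IsScaling x y I lam mu)
    (hx : IsSubdivision x) (hy : IsSubdivision y) {h g : ℝ × ℝ → ℝ} (hg : IsDensity h g)
    (hh : IsHeightFunction h) (hi : IntegrableOn (energyIntegrand 0 h g) unitSquare) :
    ∫ p in unitSquare, energyIntegrand 0 h g p
      = scaledEnergy x y lam mu - ∫ p in unitSquare, entropyDeficit x y I lam mu g p := by
  have hi' : IntegrableOn (fun p => g p * Real.log (g p)) unitSquare := by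
    rw [energyIntegrand_zero] at hi
    simpa using hi.neg
  have hinter : ∀ (u : Fin k) (v : Fin l), openRect x y u v ∩ unitSquare = openRect x y u v :=
    fun u v => inter_eq_left.2 (openRect_subset_unitSquare hx hy u v)
  have hstep := integrableOn_stepFun (x := x) (y := y) subset_rfl (scaledValue x y I lam mu)
  have hmul := integrableOn_mul_stepFun (x := x) (y := y) hg.integrableOn (scaledLog x y lam mu)
  have e1 : ∫ p in unitSquare, stepFun x y (scaledValue x y I lam mu) p = 1 := by
    rw [setIntegral_stepFun subset_rfl]
    simp only [hinter, volume_real_openRect hx hy]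
    rw [sum_mul_mul_eq_of_row (hsc.sum_scaledValue_row hx hy), hx.sum_gap]
  have e2 : ∫ p in unitSquare, g p = 1 := by
    have h1 := hg.eq_integral 0 ⟨le_rfl, zero_le_one⟩ 1 ⟨zero_le_one, le_rfl⟩
    rw [hh.left 1 ⟨zero_le_one, le_rfl⟩] at h1
    exact h1.symm
  have e3 : ∫ p in unitSquare, g p * stepFun x y (scaledLog x y lam mu) p
      = -scaledEnergy x y lam mu := by
    rw [setIntegral_mul_stepFun hg.integrableOn]
    simp only [hinter, scaledLog, add_mul, Finset.sum_add_distrib, scaledEnergy, neg_neg]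
    congr 1
    · refine Finset.sum_congr rfl fun u _ => ?_
      rw [← Finset.mul_sum, hg.sum_row hh hx hy, mul_comm]
    · rw [Finset.sum_comm]
      refine Finset.sum_congr rfl fun v _ => ?_
      rw [← Finset.mul_sum, hg.sum_col hh hx hy, mul_comm]
  have e4 : ∫ p in unitSquare, entropyDeficit x y I lam mu g p
      = 1 - 1 + (∫ p in unitSquare, g p * Real.log (g p)) + scaledEnergy x y lam mu := by
    have hsub : IntegrableOn (fun p => stepFun x y (scaledValue x y I lam mu) p - g p)
      unitSquare := hstep.sub hg.integrableOn
    have hadd : IntegrableOn (fun p => stepFun x y (scaledValue x y I lam mu) p - g p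
      + g p * Real.log (g p)) unitSquare := hsub.add hi'
    simp only [entropyDeficit]
    rw [integral_sub hadd hmul, integral_add hsub hi', integral_sub hstep hg.integrableOn,
      e1, e2, e3, sub_neg_eq_add]
  rw [e4, energyIntegrand_zero, integral_neg]
  ring

theorem integrableOn_energyIntegrand_scaled (hx : IsSubdivision x) (hy : IsSubdivision y)
    (h : ℝ × ℝ → ℝ) (c : Fin k → Fin l → ℝ) :
    IntegrableOn (energyIntegrand 0 h (stepFun x y c)) unitSquare := by
  refine (integrableOn_stepFun (x := x) (y := y) subset_rfl
    fun u v => -(c u v * Real.log (c u v))).congr_fun_ae ?_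
  filter_upwards [ae_mem_openRect hx hy] with p ⟨u, v, hp⟩
  rw [energyIntegrand_zero]
  simp only [stepFun_of_mem hx hy _ hp]

theorem permutonEnergy_scaled (hsc : IsScaling x y I lam mu) (hI : ∀ u v, I u v = 0 ∨ I u v = 1)
    (hx : IsSubdivision x) (hy : IsSubdivision y) :
    permutonEnergy 0 (stepHeight x y (scaledValue x y I lam mu))
      = (scaledEnergy x y lam mu : ℝ) := by
  have hg := isDensity_stepHeight hx hy (hsc.scaledValue_nonneg hI hx hy)
  have hh := hsc.scaledHeight_mem hI hx hy
  have hi := integrableOn_energyIntegrand_scaled hx hy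
    (stepHeight x y (scaledValue x y I lam mu)) (scaledValue x y I lam mu)
  rw [permutonEnergy_eq hg hi, hsc.setIntegral_energyIntegrand hx hy hg hh.1 hi,
    integral_eq_zero_of_ae, sub_zero]
  filter_upwards [hsc.entropyDeficit_nonneg hI hx hy hg hh] with p hp
  exact hp.2.2 rfl

theorem permutonEnergy_le (hsc : IsScaling x y I lam mu) (hI : ∀ u v, I u v = 0 ∨ I u v = 1)
    (hx : IsSubdivision x) (hy : IsSubdivision y) {h : ℝ × ℝ → ℝ}
    (hh : h ∈ restrictedHeights x y I) :
    permutonEnergy 0 h ≤ (scaledEnergy x y lam mu : ℝ) := by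
  by_cases H : ∃ g, IsDensity h g ∧ IntegrableOn (energyIntegrand 0 h g) unitSquare
  · obtain ⟨g, hg, hi⟩ := H
    rw [permutonEnergy_eq hg hi, EReal.coe_le_coe_iff,
      hsc.setIntegral_energyIntegrand hx hy hg hh.1 hi]
    exact sub_le_self _ (integral_nonneg_of_ae
      ((hsc.entropyDeficit_nonneg hI hx hy hg hh).mono fun p hp => hp.1))
  · rw [permutonEnergy, dif_neg H]
    exact bot_le

theorem isEnergyMaximizer (hsc : IsScaling x y I lam mu) (hI : ∀ u v, I u v = 0 ∨ I u v = 1)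
    (hx : IsSubdivision x) (hy : IsSubdivision y) :
    IsEnergyMaximizer 0 x y I (stepHeight x y (scaledValue x y I lam mu)) :=
  ⟨hsc.scaledHeight_mem hI hx hy, fun _ hh =>
    (hsc.permutonEnergy_le hI hx hy hh).trans (hsc.permutonEnergy_scaled hI hx hy).ge⟩

/-- Every maximizer has the density given by the scaling. -/
theorem isDensity_of_isEnergyMaximizer (hsc : IsScaling x y I lam mu)
    (hI : ∀ u v, I u v = 0 ∨ I u v = 1) (hx : IsSubdivision x) (hy : IsSubdivision y)
    {h : ℝ × ℝ → ℝ} (hmax : IsEnergyMaximizer 0 x y I h) :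
    IsDensity h (stepFun x y (scaledValue x y I lam mu)) := by
  have hle := hmax.2 _ (hsc.scaledHeight_mem hI hx hy)
  rw [hsc.permutonEnergy_scaled hI hx hy] at hle
  by_cases H : ∃ g, IsDensity h g ∧ IntegrableOn (energyIntegrand 0 h g) unitSquare
  · obtain ⟨g, hg, hi⟩ := H
    rw [permutonEnergy_eq hg hi, EReal.coe_le_coe_iff,
      hsc.setIntegral_energyIntegrand hx hy hg hmax.1.1 hi] at hle
    have hnn := hsc.entropyDeficit_nonneg hI hx hy hg hmax.1
    have h0 : ∫ p in unitSquare, entropyDeficit x y I lam mu g p = 0 :=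
      le_antisymm (by linarith) (integral_nonneg_of_ae (hnn.mono fun p hp => hp.1))
    rw [integral_eq_zero_iff_of_nonneg_ae (hnn.mono fun p hp => hp.1)
      (integrableOn_entropyDeficit hg hi)] at h0
    have hae : g =ᵐ[volume.restrict unitSquare] stepFun x y (scaledValue x y I lam mu) := by
      filter_upwards [hnn, h0] with p hp hp0
      exact hp.2.1 hp0
    -- Pointwise nonnegativity comes from the step function itself; only the integral formula passes
    -- through the almost everywhere equality.
    have hst := isDensity_stepHeight hx hy (hsc.scaledValue_nonneg hI hx hy)
    refine ⟨hst.integrableOn, hst.nonneg, fun s hs t ht => ?_⟩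
    rw [hg.eq_integral s hs t ht]
    refine integral_congr_ae (ae_restrict_of_ae_restrict_of_subset ?_ hae)
    exact prod_mono (Icc_subset_Icc_left hs.1) (Icc_subset_Icc_right ht.2)
  -- Energy `-∞` is excluded, since the scaled permuton has finite energy.
  · rw [permutonEnergy, dif_neg H] at hle
    exact absurd (le_bot_iff.1 hle) (EReal.coe_ne_bot _)

end IsScaling

end Entropy

theorem mainTheorem6 {k l : ℕ} (x : Fin (k + 1) → ℝ) (y : Fin (l + 1) → ℝ)
    (I : Fin k → Fin l → ℝ) (hx : IsSubdivision x) (hy : IsSubdivision y)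
    (hI : ∀ u v, I u v = 0 ∨ I u v = 1) (hnd : NonDegenerate x y I) :
    -- for `r = 0` a maximizer exists and is unique
    (∃ h, IsEnergyMaximizer 0 x y I h) ∧
    (∀ h h', IsEnergyMaximizer 0 x y I h → IsEnergyMaximizer 0 x y I h' →
      EqOn h h' unitSquare) ∧
    -- positive scaling sequences exist, and any of them give the density of the maximizer
    (∃ lam mu, IsScaling x y I lam mu) ∧
    (∀ h lam mu, IsEnergyMaximizer 0 x y I h → IsScaling x y I lam mu →
      ∃ g, IsDensity h g ∧ ∀ u v, ∀ p ∈ openRect x y u v,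
        g p = I u v * lam u * mu v / (gap x u * gap y v)) ∧
    -- the Sinkhorn–Knopp iterates are positive and converge to scaling sequences
    (∀ n, (∀ u, 0 < sinkhornLam x y I n u) ∧ (∀ v, 0 < sinkhornMu x y I n v)) ∧
    (∃ lam mu, IsScaling x y I lam mu ∧
      Filter.Tendsto (sinkhornLam x y I) Filter.atTop (nhds lam) ∧
      Filter.Tendsto (sinkhornMu x y I) Filter.atTop (nhds mu)) := by
  have H : Fittable x y I :=
    { hx := hx
      hy := hy
      nonneg := fun u v => by rcases hI u v with h | h <;> simp [h]
      row := fun u => (hnd.exists_row hx u).imp fun v h => by rw [h]; exact one_pos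
      col := fun v => (hnd.exists_col hy v).imp fun u h => by rw [h]; exact one_pos }
  have hsc := exists_isScaling hI hnd
  refine ⟨?_, fun h h' hh hh' => ?_, hsc, fun h lam mu hh hs => ?_, fun n => ?_,
    H.exists_tendsto_sinkhorn hsc⟩
  · obtain ⟨lam, mu, hs⟩ := hsc
    exact ⟨_, hs.isEnergyMaximizer hI hx hy⟩
  · obtain ⟨lam, mu, hs⟩ := hsc
    rintro ⟨s, t⟩ ⟨h1, h2⟩
    -- Both maximizers have the density of the same scaling, and a density determines the height on
    -- the square.
    rw [(hs.isDensity_of_isEnergyMaximizer hI hx hy hh).eq_integral s h1 t h2,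
      (hs.isDensity_of_isEnergyMaximizer hI hx hy hh').eq_integral s h1 t h2]
  · exact ⟨_, hs.isDensity_of_isEnergyMaximizer hI hx hy hh,
      fun u v p hp => stepFun_of_mem hx hy _ hp⟩
  · exact ⟨H.fitRows_pos (H.sinkhornMu_pos n), H.sinkhornMu_pos n⟩
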